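/- Let $\varepsilon=\begin{pmatrix}0&1\\-1&0\end{pmatrix}$. For a state $\varrho$ on $\mathbb C^d$ put $C^2(\varrho)=\frac{d}{d-1}(1-\operatorname{tr}\varrho^2)$. For a two-qubit state $\varrho$ let $c(\varrho)=\max\{0,\lambda_1-\lambda_2-\lambda_3-\lambda_4\}$ be its Wootters concurrence, where $\lambda_1\ge\lambda_2\ge\lambda_3\ge\lambda_4$ are the eigenvalues of $\sqrt{\sqrt\varrho\,\tilde\varrho\,\sqrt\varrho}$ and $\tilde\varrho=\overline{(\varepsilon\otimes\varepsilon)\varrho(\varepsilon\otimes\varepsilon)^\dagger}$. A two-qubit state is separable if it is a convex combination of products of one-qubit states. Let $\psi=\sum\psi^{ijkl}|ijkl\rangle\in(\mathbb C^2)^{\otimes4}$ be a unit vector with $\psi^{ijkl}=-\psi^{klij}$, and let $\pi_a$, $\pi_{ab}$ be the one- and two-qubit reduced states of $|\psi\rangle\langle\psi|$. For $v\in\mathbb C^3$ write $v^2=v_1^2+v_2^2+v_3^2$ (no conjugation) and $S(v)=\begin{pmatrix}v_1-iv_2&-v_3\\-v_3&-v_1-iv_2\end{pmatrix}$. Then there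 are unique $w,z\in\mathbb C^3$ with $$\psi^{ijkl}=\tfrac12\bigl(\varepsilon^{ik}S(z)^{jl}+S(w)^{ik}\varepsilon^{jl}\bigr),$$ and $\|w\|^2+\|z\|^2=1$. Put $r=\|i\,w\times\bar w\|$, $s=\|i\,z\times\bar z\|$, $\eta=|w^2-z^2|$, $\sigma=|w^2+z^2|$ and $p_\pm=2\|z\|^2\|w\|^2\pm\frac12(4rs-\eta^2)$. Let $H(\psi)=\frac12\sum\varepsilon_{ii'}\varepsilon_{jj'}\varepsilon_{kk'}\varepsilon_{ll'}\psi^{ijkl}\psi^{i'j'k'l'}$ and let $L(\psi)$ be the determinant of the $4\times4$ matrix $\psi^{(ij)(kl)}$. The following hold. 1. (Four-qubit invariants.) $H(\psi)=-\frac12(z^2+w^2)$ and $L(\psi)=\frac1{16}(z^2-w^2)^2$, hence $\sigma=2|H(\psi)|$ and $|L(\psi)|=\frac1{16}\eta^2$. 2. (One-qubit subsystems.) $C^2(\pi_1)=C^2(\pi_3)=1-r^2$ and $C^2(\pi_2)=C^2(\pi_4)=1-s^2$. 3. (Two-qubit subsystems.) Each $\varrho\in\{\pi_{12},\pi_{14},\pi_{23},\pi_{34}\}$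 satisfies $$c(\varrho)=\tfrac12\max\Bigl\{0,\sqrt{1-\eta^2-(r-s)^2}-\sqrt{1-(r+s)^2}\Bigr\},$$ and is separable if and only if $\eta^2\ge4rs$. Moreover $$c^2(\pi_{13})=\bigl(\|z\|^2-|w^2|\bigr)^2=s^2+\tfrac12(\eta^2+\sigma^2)-2\|z\|^2|w^2|,$$ $$c^2(\pi_{24})=\bigl(\|w\|^2-|z^2|\bigr)^2=r^2+\tfrac12(\eta^2+\sigma^2)-2\|w\|^2|z^2|.$$ 4. (Monogamy.) $\sum_{b\ne a}c^2(\pi_{ab})\le C^2(\pi_a)$ for every $a\in\{1,2,3,4\}$. 5. (Residual tangles.) Let $\Sigma_a=C^2(\pi_a)-\sum_{b\ne a}c^2(\pi_{ab})$. Always $p_-\ge0$. If $\pi_{12}$ is not separable, then $p_+\ge0$, $$c^2(\pi_{12})+c^2(\pi_{14})=1-r^2-s^2-\tfrac12\eta^2-\sqrt{\bigl(1-\eta^2-(r-s)^2\bigr)\bigl(1-(r+s)^2\bigr)},$$ $$\Sigma_1=2\|z\|^2|w^2|+\sqrt{\bigl(\tfrac12\sigma^2+p_+\bigr)\bigl(\tfrac12\sigma^2+p_-\bigr)}-\tfrac12\sigma^2,$$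 $$\Sigma_2=2\|w\|^2|z^2|+\sqrt{\bigl(\tfrac12\sigma^2+p_+\bigr)\bigl(\tfrac12\sigma^2+p_-\bigr)}-\tfrac12\sigma^2.$$ If $\pi_{12}$ is separable, then $\Sigma_1=2\|z\|^2\bigl(|w^2|+\|w\|^2\bigr)$ and $\Sigma_2=2\|w\|^2\bigl(|z^2|+\|z\|^2\bigr)$. -/

import Mathlib

noncomputable section

namespace FourQubit

open scoped Matrix Kronecker MatrixOrder ComplexOrder

/-! ### States -/

/-- The Hilbert space of four qubits; `ψ ![i, j, k, l]` is the amplitude of `|ijkl⟩`.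
The qubits 1, 2, 3, 4 carry the labels `0, 1, 2, 3 : Fin 4`. -/
abbrev Ket : Type := EuclideanSpace ℂ (Fin 4 → Fin 2)

/-- Density matrices: positive semidefinite with unit trace. -/
def IsDensity {n : Type*} [Fintype n] (ρ : Matrix n n ℂ) : Prop :=
  ρ.PosSemidef ∧ ρ.trace = 1

/-- Separable two-qubit states: convex combinations of products of one-qubit states. -/
def IsSeparable (ρ : Matrix (Fin 2 × Fin 2) (Fin 2 × Fin 2) ℂ) : Prop :=
  ρ ∈ convexHull ℝ {τ : Matrix (Fin 2 × Fin 2) (Fin 2 × Fin 2) ℂ |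
    ∃ α β : Matrix (Fin 2) (Fin 2) ℂ, IsDensity α ∧ IsDensity β ∧ τ = α ⊗ₖ β}

/-- The projector `π = |ψ⟩⟨ψ|`. -/
def proj (ψ : Ket) : Matrix (Fin 4 → Fin 2) (Fin 4 → Fin 2) ℂ :=
  Matrix.of fun x y => ψ x * star (ψ y)

/-- The one-qubit reduced state `π_a`, the partial trace over all qubits but `a`. -/
def reduced1 (ψ : Ket) (a : Fin 4) : Matrix (Fin 2) (Fin 2) ℂ :=
  Matrix.of fun i i' => ∑ x : Fin 4 → Fin 2,
    if x a = i then proj ψ x (Function.update x a i') else 0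

/-- The two-qubit reduced state `π_{ab}` for `a ≠ b`, the partial trace over the two qubits
other than `a` and `b`; the first tensor factor is qubit `a`, the second is qubit `b`. -/
def reduced2 (ψ : Ket) (a b : Fin 4) : Matrix (Fin 2 × Fin 2) (Fin 2 × Fin 2) ℂ :=
  Matrix.of fun p q => ∑ x : Fin 4 → Fin 2,
    if x a = p.1 ∧ x b = p.2 then
      proj ψ x (Function.update (Function.update x a q.1) b q.2) else 0

/-! ### Entanglement measures -/

/-- The concurrence-squared `C²(ρ) = d / (d - 1) * (1 - tr ρ²)` of a state on `ℂ^d`. -/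
def concurrenceSq {n : Type*} [Fintype n] (ρ : Matrix n n ℂ) : ℝ :=
  (Fintype.card n : ℝ) / ((Fintype.card n : ℝ) - 1) * (1 - (ρ * ρ).trace.re)

/-- The antisymmetric tensor. -/
def eps : Matrix (Fin 2) (Fin 2) ℂ := !![0, 1; -1, 0]

/-- The spin-flip `ρ̃ = ((ε ⊗ ε) ρ (ε ⊗ ε)†)^*`, with entrywise complex conjugation. -/
def spinFlip (ρ : Matrix (Fin 2 × Fin 2) (Fin 2 × Fin 2) ℂ) :
    Matrix (Fin 2 × Fin 2) (Fin 2 × Fin 2) ℂ :=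
  ((eps ⊗ₖ eps) * ρ * (eps ⊗ₖ eps)ᴴ).map star

/-- The positive matrix `√(√ρ ρ̃ √ρ)`. -/
def woottersMatrix (ρ : Matrix (Fin 2 × Fin 2) (Fin 2 × Fin 2) ℂ) :
    Matrix (Fin 2 × Fin 2) (Fin 2 × Fin 2) ℂ :=
  CFC.sqrt (CFC.sqrt ρ * spinFlip ρ * CFC.sqrt ρ)

lemma woottersMatrix_isHermitian (ρ : Matrix (Fin 2 × Fin 2) (Fin 2 × Fin 2) ℂ) :
    (woottersMatrix ρ).IsHermitian :=
  (Matrix.nonneg_iff_posSemidef.mp (CFC.sqrt_nonneg _)).isHermitian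

/-- The decreasingly ordered eigenvalues of `√(√ρ ρ̃ √ρ)`. -/
def woottersEigenvalue (ρ : Matrix (Fin 2 × Fin 2) (Fin 2 × Fin 2) ℂ) (k : Fin 4) : ℝ :=
  (woottersMatrix_isHermitian ρ).eigenvalues₀ (Fin.cast (by simp) k)

/-- The Wootters concurrence `c(ρ) = (λ₁ - λ₂ - λ₃ - λ₄)^+`. -/
def concurrence (ρ : Matrix (Fin 2 × Fin 2) (Fin 2 × Fin 2) ℂ) : ℝ :=
  max 0 (woottersEigenvalue ρ 0 - woottersEigenvalue ρ 1 - woottersEigenvalue ρ 2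
    - woottersEigenvalue ρ 3)

/-- The residual tangle `C²(π_a) - ∑_{b ≠ a} c²(π_{ab})` of qubit `a`. -/
def residualTangle (ψ : Ket) (a : Fin 4) : ℝ :=
  concurrenceSq (reduced1 ψ a) - ∑ b ∈ Finset.univ.erase a, concurrence (reduced2 ψ a b) ^ 2

/-! ### Polynomial four-qubit invariants -/

/-- `H(ψ) = ½ ε_{ii'} ε_{jj'} ε_{kk'} ε_{ll'} ψ^{ijkl} ψ^{i'j'k'l'}`. -/
def invH (ψ : Ket) : ℂ :=
  1 / 2 * ∑ x : Fin 4 → Fin 2, ∑ y : Fin 4 → Fin 2, (∏ a, eps (x a) (y a)) * ψ x * ψ y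

/-- `L(ψ)`, the determinant of the amplitudes arranged as a matrix with row index `ij` and
column index `kl`. -/
def invL (ψ : Ket) : ℂ :=
  (Matrix.of fun p q : Fin 2 × Fin 2 => ψ ![p.1, p.2, q.1, q.2]).det

/-! ### The antisymmetric states and their parametrization -/

/-- Antisymmetry under the exchange of the pairs 12 and 34. -/
def IsAntisymm (ψ : Ket) : Prop :=
  ∀ i j k l : Fin 2, ψ ![i, j, k, l] = -ψ ![k, l, i, j]

/-- The symmetric matrix `ε (v · σ̄)` belonging to `v ∈ ℂ³`. -/
def symMat (v : EuclideanSpace ℂ (Fin 3)) : Matrix (Fin 2) (Fin 2) ℂ :=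
  !![v 0 - Complex.I * v 1, -v 2; -v 2, -v 0 - Complex.I * v 1]

/-- `ψ^{ijkl} = ½ (ε^{ik} A^{jl} + B^{ik} ε^{jl})` with `A` and `B` the symmetric matrices
belonging to `z` and `w`. -/
def fermionicState (w z : EuclideanSpace ℂ (Fin 3)) : Ket :=
  WithLp.toLp 2 fun x =>
    1 / 2 * (eps (x 0) (x 2) * symMat z (x 1) (x 3) + symMat w (x 0) (x 2) * eps (x 1) (x 3))

/-- The complex number `v² = v₁² + v₂² + v₃²` (no conjugation). -/
def bsq (v : EuclideanSpace ℂ (Fin 3)) : ℂ := ∑ k, v k ^ 2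

/-- The length of the (real) vector `i v × v̄`; `r = crossNorm w`, `s = crossNorm z`. -/
def crossNorm (v : EuclideanSpace ℂ (Fin 3)) : ℝ :=
  ‖(WithLp.toLp 2 (Complex.I • crossProduct (v.ofLp) (star v.ofLp)) : EuclideanSpace ℂ (Fin 3))‖

def eta (w z : EuclideanSpace ℂ (Fin 3)) : ℝ := ‖bsq w - bsq z‖

def sigma (w z : EuclideanSpace ℂ (Fin 3)) : ℝ := ‖bsq w + bsq z‖

/-- `p_+ = 2 ‖z‖² ‖w‖² + ½ (4 r s - η²)`. -/
def pPlus (w z : EuclideanSpace ℂ (Fin 3)) : ℝ :=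
  2 * ‖z‖ ^ 2 * ‖w‖ ^ 2 + 1 / 2 * (4 * crossNorm w * crossNorm z - eta w z ^ 2)

/-- `p_- = 2 ‖z‖² ‖w‖² - ½ (4 r s - η²)`. -/
def pMinus (w z : EuclideanSpace ℂ (Fin 3)) : ℝ :=
  2 * ‖z‖ ^ 2 * ‖w‖ ^ 2 - 1 / 2 * (4 * crossNorm w * crossNorm z - eta w z ^ 2)

end FourQubit

end

/-!
# Antisymmetric four-qubit states

Write `A = S(z)`, `B = S(w)` for the two symmetric matrices of the parametrization. Contracting `ψ`
with `ε` in the pair 13 or 24 returns `A` or `B`, so every antisymmetric state has exactly one pair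
of parameters (`existsUnique_parameters`).

*Normal form.* Across the cut 12|34 the amplitudes form the matrix `M = ½ (ε ⊗ A + B ⊗ ε)`, and
the reduced states of 12, 14, 23 and 34 are all of the form `M Mᴴ`, with signs of `w`, `z` and
their roles changed. For `U, V ∈ SU(2)` the local unitary `U ⊗ V` acts on `M` by `A ↦ V A Vᵀ`,
`B ↦ U B Uᵀ`. Choosing a real unit vector `n` with `n · w = 0` and a basis of eigenvectors of
`n · σ` makes `U B Uᵀ` diagonal, with entries `b₀, b₁` satisfying `|b₀|² + |b₁|² = 2 ‖w‖²`,
`b₀ b₁ = -w²` and `r = ½ ||b₀|² - |b₁|²|` (`exists_isSpecialUnitary_canonical`). For diagonal `A`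
and `B` every two-qubit reduced state is an X-state: its only nonzero entries lie on the diagonal
`d` and at the coherences `p = ⟨00|ρ|11⟩` and `q = ⟨01|ρ|10⟩`.

*X-states.* For `f² = d₀ d₃` and `g² = d₁ d₂` the matrix `ρ ρ̃` has the eigenvalues `(f ± |p|)²` and
`(g ± |q|)²`, and these determine the concurrence, `2 max {0, |p| - g, |q| - f}`
(`concurrence_xState`). An X-state is separable exactly when `|p| ≤ g` and `|q| ≤ f`
(`isSeparable_xState_iff`): necessity is the Peres criterion. For sufficiency, after a separable
diagonal part is split off, one has `d₀ d₃ = d₁ d₂ = m²`; such a state with `|p| = |q| = m` is a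
mixture of two product states, and the coherences of modulus at most `m` are convex combinations of
those of modulus `m`.

*Conclusion.* For the pair 12 the quantities `16 f²`, `16 g²` are `1 - (r ± s)²` in some order, and
`16 (f² - |p|²) = 16 (g² - |q|²) = η²`; this gives the concurrence and the separability threshold
`η² = 4 r s`. For the pair 13 the state is the mixture of a singlet and of the vector `B`. The
tangle formulas follow from `η² + σ² = 2 (|w²|² + |z²|²)` and `r² = ‖w‖⁴ - |w²|²`: the two radicands
are `½ σ² + p_±`, and `p_± ≥ 0` yields the monogamy inequalities.
-/

namespace FourQubit

open Matrix Polynomial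
open scoped Kronecker MatrixOrder ComplexOrder

/-! ### Wootters eigenvalues from a characteristic polynomial -/

lemma posSemidef_spinFlip {ρ : Matrix (Fin 2 × Fin 2) (Fin 2 × Fin 2) ℂ} (hρ : ρ.PosSemidef) :
    (spinFlip ρ).PosSemidef := by
  have h := (hρ.mul_mul_conjTranspose_same (eps ⊗ₖ eps)).conjTranspose.transpose
  exact h

lemma charpoly_woottersMatrix_mul_self {ρ : Matrix (Fin 2 × Fin 2) (Fin 2 × Fin 2) ℂ}
    (hρ : ρ.PosSemidef) :
    (woottersMatrix ρ * woottersMatrix ρ).charpoly = (ρ * spinFlip ρ).charpoly := by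
  have h0 : 0 ≤ CFC.sqrt ρ * spinFlip ρ * CFC.sqrt ρ := by
    rw [Matrix.nonneg_iff_posSemidef]
    have h1 : (CFC.sqrt ρ).IsHermitian :=
      (Matrix.nonneg_iff_posSemidef.mp (CFC.sqrt_nonneg _)).isHermitian
    have := (posSemidef_spinFlip hρ).mul_mul_conjTranspose_same (CFC.sqrt ρ)
    rwa [h1.eq] at this
  rw [woottersMatrix, CFC.sqrt_mul_sqrt_self _ h0, Matrix.mul_assoc, Matrix.charpoly_mul_comm,
    Matrix.mul_assoc, CFC.sqrt_mul_sqrt_self _ (Matrix.nonneg_iff_posSemidef.mpr hρ),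
    Matrix.charpoly_mul_comm]

lemma roots_charpoly_mul_self_of_isHermitian {n : Type*} [Fintype n] [DecidableEq n]
    {A : Matrix n n ℂ} (hA : A.IsHermitian) :
    (A * A).charpoly.roots = Finset.univ.val.map fun i => ((hA.eigenvalues₀ i ^ 2 : ℝ) : ℂ) := by
  have h := hA.charpoly_cfc_eq (fun x => x ^ 2)
  have h2 : cfc (fun x : ℝ => x ^ 2) A = A * A := by
    rw [cfc_pow_id (R := ℝ) A 2 hA.isSelfAdjoint, pow_two]
  rw [h2] at h
  rw [h, Polynomial.roots_prod _ _
    (Finset.prod_ne_zero_iff.mpr fun _ _ => Polynomial.X_sub_C_ne_zero _)]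
  simp only [roots_X_sub_C, Multiset.bind_singleton, IsHermitian.eigenvalues]
  have hc := Multiset.map_map (fun i => ((hA.eigenvalues₀ i ^ 2 : ℝ) : ℂ))
    (Fintype.equivOfCardEq (Fintype.card_fin (Fintype.card n))).symm Finset.univ.val
  rw [Multiset.map_univ_val_equiv] at hc
  exact hc.symm

lemma woottersEigenvalue_nonneg (ρ : Matrix (Fin 2 × Fin 2) (Fin 2 × Fin 2) ℂ) (k : Fin 4) :
    0 ≤ woottersEigenvalue ρ k := by
  have hp : (woottersMatrix ρ).PosSemidef := Matrix.nonneg_iff_posSemidef.mp (CFC.sqrt_nonneg _)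
  have := hp.eigenvalues_nonneg
    (Fintype.equivOfCardEq (Fintype.card_fin _) (Fin.cast (by simp) k))
  simpa [IsHermitian.eigenvalues, woottersEigenvalue] using this

lemma woottersEigenvalue_le_zero (ρ : Matrix (Fin 2 × Fin 2) (Fin 2 × Fin 2) ℂ) (k : Fin 4) :
    woottersEigenvalue ρ k ≤ woottersEigenvalue ρ 0 :=
  (woottersMatrix_isHermitian ρ).eigenvalues₀_antitone (by simp)

/-- The numbers `μ i` need not be ordered: since `λ₁ - λ₂ - λ₃ - λ₄ = 2 λ₁ - ∑ λ`, only the largest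
one has to be singled out. -/
lemma concurrence_eq_of_charpoly {ρ : Matrix (Fin 2 × Fin 2) (Fin 2 × Fin 2) ℂ}
    (hρ : ρ.PosSemidef) (μ : Fin 4 → ℝ) (h0 : ∀ i, 0 ≤ μ i) (hmax : ∀ i, μ i ≤ μ 0)
    (hχ : (ρ * spinFlip ρ).charpoly = ∏ i, (X - C ((μ i ^ 2 : ℝ) : ℂ))) :
    concurrence ρ = max 0 (μ 0 - μ 1 - μ 2 - μ 3) := by
  have hW := woottersMatrix_isHermitian ρ
  have hsq : Finset.univ.val.map (fun i => ((woottersEigenvalue ρ i ^ 2 : ℝ) : ℂ)) =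
      Finset.univ.val.map fun i => ((μ i ^ 2 : ℝ) : ℂ) := by
    have h1 := roots_charpoly_mul_self_of_isHermitian hW
    rw [charpoly_woottersMatrix_mul_self hρ, hχ, Polynomial.roots_prod _ _
      (Finset.prod_ne_zero_iff.mpr fun _ _ => Polynomial.X_sub_C_ne_zero _)] at h1
    simp only [roots_X_sub_C, Multiset.bind_singleton] at h1
    rw [h1]
    rfl
  have hms : Finset.univ.val.map (woottersEigenvalue ρ) = Finset.univ.val.map μ := by
    have := congrArg (Multiset.map fun x : ℂ => √x.re) hsq
    simpa [Multiset.map_map, Function.comp_def, Real.sqrt_sq, woottersEigenvalue_nonneg, h0,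
      ← Complex.ofReal_pow]
      using this
  have hsum : ∑ i, woottersEigenvalue ρ i = ∑ i, μ i := congrArg Multiset.sum hms
  -- Both sides are the maximum of the same multiset.
  have hle : woottersEigenvalue ρ 0 = μ 0 := by
    apply le_antisymm
    · have : woottersEigenvalue ρ 0 ∈ Finset.univ.val.map μ := by
        rw [← hms]; exact Multiset.mem_map_of_mem _ (Finset.mem_univ_val _)
      obtain ⟨i, -, hi⟩ := Multiset.mem_map.mp this
      exact hi ▸ hmax i
    · have : μ 0 ∈ Finset.univ.val.map (woottersEigenvalue ρ) := by
        rw [hms]; exact Multiset.mem_map_of_mem _ (Finset.mem_univ_val _)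
      obtain ⟨i, -, hi⟩ := Multiset.mem_map.mp this
      exact hi ▸ woottersEigenvalue_le_zero ρ i
  rw [Fin.sum_univ_four, Fin.sum_univ_four] at hsum
  rw [concurrence]
  congr 1
  linarith

/-! ### Local unitaries and the exchange of the two qubits -/

/-- `U` belongs to `SU(2)`: it is unitary and preserves the antisymmetric tensor. -/
def IsSpecialUnitary (U : Matrix (Fin 2) (Fin 2) ℂ) : Prop :=
  U * Uᴴ = 1 ∧ U * eps * Uᵀ = eps

lemma IsSpecialUnitary.conj_mul_eps {U : Matrix (Fin 2) (Fin 2) ℂ} (hU : IsSpecialUnitary U) :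
    U.map star * eps = eps * U := by
  have h1 : Uᴴ * U = 1 := mul_eq_one_comm.mp hU.1
  have h2 : U.map star * Uᵀ = 1 := by
    have := congrArg Matrix.transpose h1
    rwa [transpose_mul, transpose_one, mul_eq_one_comm] at this
  have hT : Uᵀ * U.map star = 1 := mul_eq_one_comm.mp h2
  have h3 : eps = U * eps * Uᵀ := hU.2.symm
  have h4 : eps * U.map star = U * eps := by
    conv_lhs => rw [h3]
    rw [Matrix.mul_assoc, hT, Matrix.mul_one]
  have he : eps.map star = eps := by
    ext i j; fin_cases i <;> fin_cases j <;> simp [eps]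
  have h5 := congrArg (fun M : Matrix (Fin 2) (Fin 2) ℂ => M.map (starRingEnd ℂ)) h4
  simp only [Matrix.map_mul] at h5
  have he' : eps.map (starRingEnd ℂ) = eps := he
  have hUU : (U.map star).map (starRingEnd ℂ) = U := by ext i j; simp
  rw [he', hUU] at h5
  exact h5.symm

lemma IsSpecialUnitary.conjTranspose {U : Matrix (Fin 2) (Fin 2) ℂ} (hU : IsSpecialUnitary U) :
    IsSpecialUnitary Uᴴ := by
  have h1 : Uᴴ * U = 1 := mul_eq_one_comm.mp hU.1
  refine ⟨by rwa [conjTranspose_conjTranspose], ?_⟩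
  have h2 : Uᴴᵀ = U.map star := by ext i j; simp
  rw [h2, Matrix.mul_assoc]
  have h4 : eps * U.map star = U * eps := by
    have hT : Uᵀ * U.map star = 1 := by
      have := congrArg Matrix.transpose h1
      rwa [transpose_mul, transpose_one] at this
    conv_lhs => rw [← hU.2]
    rw [Matrix.mul_assoc, hT, Matrix.mul_one]
  rw [h4, ← Matrix.mul_assoc, h1, Matrix.one_mul]

lemma spinFlip_conj {U V : Matrix (Fin 2) (Fin 2) ℂ} (hU : IsSpecialUnitary U)
    (hV : IsSpecialUnitary V) (ρ : Matrix (Fin 2 × Fin 2) (Fin 2 × Fin 2) ℂ) :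
    spinFlip ((U ⊗ₖ V) * ρ * (U ⊗ₖ V)ᴴ) = (U ⊗ₖ V) * spinFlip ρ * (U ⊗ₖ V)ᴴ := by
  set L := U ⊗ₖ V
  set E := eps ⊗ₖ eps
  have hc : L.map star * E = E * L := by
    have : L.map star = U.map star ⊗ₖ V.map star := by ext ⟨i, j⟩ ⟨k, l⟩; simp [L]
    rw [this, ← mul_kronecker_mul, ← mul_kronecker_mul, hU.conj_mul_eps, hV.conj_mul_eps]
  have hm : ∀ A B : Matrix (Fin 2 × Fin 2) (Fin 2 × Fin 2) ℂ,
      (A * B).map star = A.map star * B.map star := fun A B => by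
    exact Matrix.map_mul (f := starRingEnd ℂ)
  have hss : (L.map star).map star = L := by ext i j; simp
  have hc' : E * L * ρ * (E * L)ᴴ = L.map star * (E * ρ * Eᴴ) * (L.map star)ᴴ := by
    rw [← hc, conjTranspose_mul]; simp only [Matrix.mul_assoc]
  have h6 : ((L.map star)ᴴ).map star = Lᴴ := by ext i j; simp
  have h7 : E * (L * ρ * Lᴴ) * Eᴴ = E * L * ρ * (E * L)ᴴ := by
    rw [conjTranspose_mul]; simp only [Matrix.mul_assoc]
  change (E * (L * ρ * Lᴴ) * Eᴴ).map star = L * (E * ρ * Eᴴ).map star * Lᴴ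
  rw [h7, hc', hm, hm, hss, h6]

lemma kronecker_isometry {U V : Matrix (Fin 2) (Fin 2) ℂ} (hU : IsSpecialUnitary U)
    (hV : IsSpecialUnitary V) : (U ⊗ₖ V)ᴴ * (U ⊗ₖ V) = 1 := by
  rw [conjTranspose_kronecker, ← mul_kronecker_mul, mul_eq_one_comm.mp hU.1,
    mul_eq_one_comm.mp hV.1, one_kronecker_one]

/-- The concurrence depends on `ρ` only through the characteristic polynomial of `ρ ρ̃`. -/
lemma concurrence_congr {ρ ρ' : Matrix (Fin 2 × Fin 2) (Fin 2 × Fin 2) ℂ}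
    (hρ : ρ.PosSemidef) (hρ' : ρ'.PosSemidef)
    (h : (ρ' * spinFlip ρ').charpoly = (ρ * spinFlip ρ).charpoly) :
    concurrence ρ' = concurrence ρ := by
  rw [concurrence_eq_of_charpoly hρ' (woottersEigenvalue ρ) (woottersEigenvalue_nonneg ρ)
    (woottersEigenvalue_le_zero ρ), concurrence]
  rw [h, ← charpoly_woottersMatrix_mul_self hρ]
  have h2 : cfc (fun x : ℝ => x ^ 2) (woottersMatrix ρ) = woottersMatrix ρ * woottersMatrix ρ := by
    rw [cfc_pow_id (R := ℝ) _ 2 (woottersMatrix_isHermitian ρ).isSelfAdjoint, pow_two]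
  rw [← h2, (woottersMatrix_isHermitian ρ).charpoly_cfc_eq]
  simp only [IsHermitian.eigenvalues]
  rw [← Equiv.prod_comp (Fintype.equivOfCardEq (Fintype.card_fin _))]
  simp only [Equiv.symm_apply_apply]
  rfl

lemma concurrence_conj {U V : Matrix (Fin 2) (Fin 2) ℂ} (hU : IsSpecialUnitary U)
    (hV : IsSpecialUnitary V) {ρ : Matrix (Fin 2 × Fin 2) (Fin 2 × Fin 2) ℂ}
    (hρ : ρ.PosSemidef) :
    concurrence ((U ⊗ₖ V) * ρ * (U ⊗ₖ V)ᴴ) = concurrence ρ := by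
  refine concurrence_congr hρ (hρ.mul_mul_conjTranspose_same _) ?_
  have h1 := kronecker_isometry hU hV
  rw [spinFlip_conj hU hV]
  generalize U ⊗ₖ V = L at *
  have : L * ρ * Lᴴ * (L * spinFlip ρ * Lᴴ) = L * (ρ * spinFlip ρ * Lᴴ) := by
    calc _ = L * ρ * (Lᴴ * L) * spinFlip ρ * Lᴴ := by simp only [Matrix.mul_assoc]
      _ = _ := by rw [h1, Matrix.mul_one]; simp only [Matrix.mul_assoc]
  rw [this, Matrix.charpoly_mul_comm, Matrix.mul_assoc, h1, Matrix.mul_one]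

lemma spinFlip_swap (ρ : Matrix (Fin 2 × Fin 2) (Fin 2 × Fin 2) ℂ) :
    spinFlip (ρ.submatrix Prod.swap Prod.swap) = (spinFlip ρ).submatrix Prod.swap Prod.swap := by
  have hE : (eps ⊗ₖ eps).submatrix (Equiv.prodComm (Fin 2) (Fin 2)) (Equiv.prodComm _ _) =
      eps ⊗ₖ eps := by
    ext ⟨i, j⟩ ⟨k, l⟩; simp [mul_comm]
  have hE' : (eps ⊗ₖ eps)ᴴ.submatrix (Equiv.prodComm (Fin 2) (Fin 2)) (Equiv.prodComm _ _) =
      (eps ⊗ₖ eps)ᴴ := by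
    rw [← Matrix.conjTranspose_submatrix, hE]
  have h : (eps ⊗ₖ eps * ρ * (eps ⊗ₖ eps)ᴴ).submatrix (Equiv.prodComm (Fin 2) (Fin 2))
      (Equiv.prodComm _ _) = eps ⊗ₖ eps * ρ.submatrix (Equiv.prodComm (Fin 2) (Fin 2))
        (Equiv.prodComm _ _) * (eps ⊗ₖ eps)ᴴ := by
    rw [← Matrix.submatrix_mul_equiv _ _ _ (Equiv.prodComm (Fin 2) (Fin 2)),
      ← Matrix.submatrix_mul_equiv _ _ _ (Equiv.prodComm (Fin 2) (Fin 2)), hE, hE']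
  exact congrArg (fun M => M.map star) h.symm

lemma concurrence_swap {ρ : Matrix (Fin 2 × Fin 2) (Fin 2 × Fin 2) ℂ} (hρ : ρ.PosSemidef) :
    concurrence (ρ.submatrix Prod.swap Prod.swap) = concurrence ρ := by
  refine concurrence_congr hρ (hρ.submatrix _) ?_
  have h : ρ.submatrix Prod.swap Prod.swap * spinFlip (ρ.submatrix Prod.swap Prod.swap) =
      (ρ * spinFlip ρ).submatrix (Equiv.prodComm _ _) (Equiv.prodComm _ _) := by
    rw [spinFlip_swap]
    exact Matrix.submatrix_mul_equiv ρ (spinFlip ρ) Prod.swap (Equiv.prodComm _ _) Prod.swap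
  rw [h]
  have h2 := Matrix.charpoly_reindex (Equiv.prodComm (Fin 2) (Fin 2)) (ρ * spinFlip ρ)
  rwa [Matrix.reindex_apply, Equiv.prodComm_symm] at h2

lemma IsDensity.conj {U α : Matrix (Fin 2) (Fin 2) ℂ} (hU : IsSpecialUnitary U)
    (hα : IsDensity α) : IsDensity (U * α * Uᴴ) := by
  refine ⟨hα.1.mul_mul_conjTranspose_same U, ?_⟩
  rw [Matrix.trace_mul_comm, ← Matrix.mul_assoc, mul_eq_one_comm.mp hU.1, Matrix.one_mul, hα.2]

lemma IsSeparable.conj {U V : Matrix (Fin 2) (Fin 2) ℂ} (hU : IsSpecialUnitary U)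
    (hV : IsSpecialUnitary V) {ρ : Matrix (Fin 2 × Fin 2) (Fin 2 × Fin 2) ℂ}
    (hρ : IsSeparable ρ) : IsSeparable ((U ⊗ₖ V) * ρ * (U ⊗ₖ V)ᴴ) := by
  let f : Matrix (Fin 2 × Fin 2) (Fin 2 × Fin 2) ℂ →ₗ[ℝ] Matrix (Fin 2 × Fin 2) (Fin 2 × Fin 2) ℂ :=
    { toFun := fun ρ => (U ⊗ₖ V) * ρ * (U ⊗ₖ V)ᴴ
      map_add' := fun x y => by rw [Matrix.mul_add, Matrix.add_mul]
      map_smul' := fun c x => by simp }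
  have hsub := convexHull_min (t := f ⁻¹' {τ | IsSeparable τ}) ?_
    ((convex_convexHull ℝ _).linear_preimage f) hρ
  · exact hsub
  · rintro _ ⟨α, β, hα, hβ, rfl⟩
    refine subset_convexHull ℝ _ ⟨U * α * Uᴴ, V * β * Vᴴ, hα.conj hU, hβ.conj hV, ?_⟩
    change (U ⊗ₖ V) * (α ⊗ₖ β) * (U ⊗ₖ V)ᴴ = _
    rw [conjTranspose_kronecker, ← mul_kronecker_mul, ← mul_kronecker_mul]

lemma isSeparable_conj_iff {U V : Matrix (Fin 2) (Fin 2) ℂ} (hU : IsSpecialUnitary U)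
    (hV : IsSpecialUnitary V) {ρ : Matrix (Fin 2 × Fin 2) (Fin 2 × Fin 2) ℂ} :
    IsSeparable ((U ⊗ₖ V) * ρ * (U ⊗ₖ V)ᴴ) ↔ IsSeparable ρ := by
  refine ⟨fun h => ?_, fun h => h.conj hU hV⟩
  have := h.conj hU.conjTranspose hV.conjTranspose
  rw [← conjTranspose_kronecker, conjTranspose_conjTranspose] at this
  have h1 := kronecker_isometry hU hV
  generalize U ⊗ₖ V = L at *
  have e : Lᴴ * (L * ρ * Lᴴ) * L = ρ := by
    calc _ = (Lᴴ * L) * ρ * (Lᴴ * L) := by simp only [Matrix.mul_assoc]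
      _ = ρ := by rw [h1, Matrix.one_mul, Matrix.mul_one]
  rwa [e] at this

/-! ### X-states -/

/-- The Hermitian matrix with diagonal `d` in the basis `|00⟩, |01⟩, |10⟩, |11⟩` whose only other
nonzero entries are the coherences `p = ⟨00|·|11⟩` and `q = ⟨01|·|10⟩` and their conjugates. -/
noncomputable def xState (d : Fin 4 → ℝ) (p q : ℂ) : Matrix (Fin 2 × Fin 2) (Fin 2 × Fin 2) ℂ :=
  (!![(d 0 : ℂ), 0, 0, p; 0, d 1, q, 0; 0, star q, d 2, 0; star p, 0, 0, d 3]).submatrix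
    finProdFinEquiv finProdFinEquiv

lemma charpoly_xShape (a b c d e f g h : ℂ) :
    (!![a, 0, 0, b; 0, c, d, 0; 0, e, f, 0; g, 0, 0, h] : Matrix (Fin 4) (Fin 4) ℂ).charpoly =
      ((X - C a) * (X - C h) - C b * C g) * ((X - C c) * (X - C f) - C d * C e) := by
  simp [charpoly, charmatrix, det_succ_row_zero, Fin.sum_univ_succ, Fin.succAbove, submatrix]
  ring

lemma spinFlip_xState (d : Fin 4 → ℝ) (p q : ℂ) :
    spinFlip (xState d p q) = xState (fun i => d i.rev) p q := by
  ext ⟨i, j⟩ ⟨k, l⟩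
  fin_cases i <;> fin_cases j <;> fin_cases k <;> fin_cases l <;>
  simp [spinFlip, xState, eps, Matrix.mul_apply, Fintype.sum_prod_type, finProdFinEquiv, Fin.rev]

lemma charpoly_xState_mul_spinFlip (d : Fin 4 → ℝ) (p q : ℂ) {f g : ℝ}
    (hf : f ^ 2 = d 0 * d 3) (hg : g ^ 2 = d 1 * d 2) :
    (xState d p q * spinFlip (xState d p q)).charpoly =
      (X - C (((f + ‖p‖) ^ 2 : ℝ) : ℂ)) * (X - C (((f - ‖p‖) ^ 2 : ℝ) : ℂ)) *
      ((X - C (((g + ‖q‖) ^ 2 : ℝ) : ℂ)) * (X - C (((g - ‖q‖) ^ 2 : ℝ) : ℂ))) := by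
  have hp : p * star p = ((‖p‖ ^ 2 : ℝ) : ℂ) := by
    simpa using Complex.mul_conj' p
  have hq : q * star q = ((‖q‖ ^ 2 : ℝ) : ℂ) := by
    simpa using Complex.mul_conj' q
  have hf' : (f : ℂ) ^ 2 = d 0 * d 3 := by exact_mod_cast hf
  have hg' : (g : ℂ) ^ 2 = d 1 * d 2 := by exact_mod_cast hg
  rw [spinFlip_xState, xState, xState, Matrix.submatrix_mul_equiv]
  have h1 := Matrix.charpoly_reindex (finProdFinEquiv (m := 2) (n := 2)).symm
    (!![(d 0 : ℂ), 0, 0, p; 0, d 1, q, 0; 0, star q, d 2, 0; star p, 0, 0, d 3] *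
      !![(d 3 : ℂ), 0, 0, p; 0, d 2, q, 0; 0, star q, d 1, 0; star p, 0, 0, d 0])
  rw [Matrix.reindex_apply, Equiv.symm_symm] at h1
  refine h1.trans ?_
  have h2 : (!![(d 0 : ℂ), 0, 0, p; 0, d 1, q, 0; 0, star q, d 2, 0; star p, 0, 0, d 3] *
      !![(d 3 : ℂ), 0, 0, p; 0, d 2, q, 0; 0, star q, d 1, 0; star p, 0, 0, d 0]) =
      !![(f : ℂ) ^ 2 + p * star p, 0, 0, 2 * d 0 * p; 0, (g : ℂ) ^ 2 + q * star q, 2 * d 1 * q, 0;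
        0, 2 * d 2 * star q, (g : ℂ) ^ 2 + q * star q, 0;
        2 * d 3 * star p, 0, 0, (f : ℂ) ^ 2 + p * star p] := by
    ext i j
    fin_cases i <;> fin_cases j <;> simp [Matrix.mul_apply, Fin.sum_univ_four, hf', hg'] <;> ring
  rw [h2, charpoly_xShape, ← C_mul, ← C_mul,
    show 2 * (d 0 : ℂ) * p * (2 * d 3 * star p) = 4 * f ^ 2 * (p * star p) by rw [hf']; ring,
    show 2 * (d 1 : ℂ) * q * (2 * d 2 * star q) = 4 * g ^ 2 * (q * star q) by rw [hg']; ring,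
    hp, hq]
  simp only [Complex.ofReal_pow, Complex.ofReal_add, Complex.ofReal_sub, C_add, C_sub, C_mul,
    C_pow, map_ofNat]
  ring

lemma concurrence_xState {d : Fin 4 → ℝ} {p q : ℂ} (hX : (xState d p q).PosSemidef) {f g : ℝ}
    (hf : f ^ 2 = d 0 * d 3) (hg : g ^ 2 = d 1 * d 2) (hpf : ‖p‖ ≤ f) (hqg : ‖q‖ ≤ g) :
    concurrence (xState d p q) = 2 * max 0 (max (‖p‖ - g) (‖q‖ - f)) := by
  have hχ := charpoly_xState_mul_spinFlip d p q hf hg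
  have hp := norm_nonneg p
  have hq := norm_nonneg q
  rcases le_total (g + ‖q‖) (f + ‖p‖) with h | h
  · rw [concurrence_eq_of_charpoly hX ![f + ‖p‖, f - ‖p‖, g + ‖q‖, g - ‖q‖] ?_ ?_ ?_]
    · -- The block of `p` holds the largest eigenvalue, so `‖q‖ - f ≤ ‖p‖ - g`.
      rw [max_eq_left (b := ‖q‖ - f) (by linarith), mul_max_of_nonneg _ _ zero_le_two]
      simp
      ring_nf
    · intro i; fin_cases i <;> simp <;> linarith
    · intro i; fin_cases i <;> simp <;> linarith
    · rw [hχ]; simp [Fin.prod_univ_four, mul_assoc]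
  · rw [concurrence_eq_of_charpoly hX ![g + ‖q‖, g - ‖q‖, f + ‖p‖, f - ‖p‖] ?_ ?_ ?_]
    · rw [max_eq_right (b := ‖q‖ - f) (by linarith), mul_max_of_nonneg _ _ zero_le_two]
      simp
      ring_nf
    · intro i; fin_cases i <;> simp <;> linarith
    · intro i; fin_cases i <;> simp <;> linarith
    · rw [hχ]; simp [Fin.prod_univ_four]; ring

/-! ### Separability of X-states -/

/-- The partial transpose on the second qubit. -/
def partialTranspose :
    Matrix (Fin 2 × Fin 2) (Fin 2 × Fin 2) ℂ →ₗ[ℝ] Matrix (Fin 2 × Fin 2) (Fin 2 × Fin 2) ℂ where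
  toFun ρ := Matrix.of fun x y => ρ (x.1, y.2) (y.1, x.2)
  map_add' _ _ := rfl
  map_smul' _ _ := rfl

lemma partialTranspose_apply (ρ : Matrix (Fin 2 × Fin 2) (Fin 2 × Fin 2) ℂ) (x y : Fin 2 × Fin 2) :
    partialTranspose ρ x y = ρ (x.1, y.2) (y.1, x.2) := rfl

lemma convex_posSemidef {n : Type*} [Fintype n] : Convex ℝ {A : Matrix n n ℂ | A.PosSemidef} := by
  intro A hA B hB a b ha hb _
  exact (PosSemidef.smul hA ha).add (PosSemidef.smul hB hb)

/-- The Peres criterion. -/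
lemma IsSeparable.posSemidef_partialTranspose {ρ : Matrix (Fin 2 × Fin 2) (Fin 2 × Fin 2) ℂ}
    (hρ : IsSeparable ρ) : (partialTranspose ρ).PosSemidef := by
  refine convexHull_min (t := partialTranspose ⁻¹' {A | A.PosSemidef}) ?_
    (convex_posSemidef.linear_preimage partialTranspose) hρ
  rintro _ ⟨α, β, hα, hβ, rfl⟩
  exact hα.1.kronecker hβ.1.transpose

lemma sq_norm_le_of_posSemidef {n : Type*} [Fintype n] [DecidableEq n] {A : Matrix n n ℂ}
    (hA : A.PosSemidef) (i j : n) : ‖A i j‖ ^ 2 ≤ (A i i).re * (A j j).re := by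
  have h := (hA.submatrix ![i, j]).det_nonneg
  rw [det_fin_two] at h
  have hij : A j i = star (A i j) := (hA.isHermitian.apply j i).symm
  have hii := (Complex.nonneg_iff.mp (hA.diag_nonneg (i := i))).2
  have h1 := (Complex.nonneg_iff.mp h).1
  simp [hij, Complex.mul_conj, ← hii, Complex.normSq_eq_norm_sq] at h1
  norm_cast at h1

lemma le_of_isSeparable_xState {d : Fin 4 → ℝ} {p q : ℂ} {f g : ℝ} (hf0 : 0 ≤ f) (hg0 : 0 ≤ g)
    (hf : f ^ 2 = d 0 * d 3) (hg : g ^ 2 = d 1 * d 2) (h : IsSeparable (xState d p q)) :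
    ‖p‖ ≤ g ∧ ‖q‖ ≤ f := by
  have hT := h.posSemidef_partialTranspose
  have h1 := sq_norm_le_of_posSemidef hT (0, 1) (1, 0)
  have h2 := sq_norm_le_of_posSemidef hT (0, 0) (1, 1)
  simp [partialTranspose_apply, xState, finProdFinEquiv] at h1 h2
  constructor <;> apply le_of_sq_le_sq _ ‹_› <;> nlinarith

/-- `τ` is a nonnegative multiple of a separable state. -/
def InSepCone (τ : Matrix (Fin 2 × Fin 2) (Fin 2 × Fin 2) ℂ) : Prop :=
  ∃ t : ℝ, 0 ≤ t ∧ ∃ ρ, IsSeparable ρ ∧ τ = t • ρ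

lemma InSepCone.smul {τ : Matrix (Fin 2 × Fin 2) (Fin 2 × Fin 2) ℂ} (h : InSepCone τ) {a : ℝ}
    (ha : 0 ≤ a) : InSepCone (a • τ) := by
  obtain ⟨t, ht, ρ, hρ, rfl⟩ := h
  exact ⟨a * t, mul_nonneg ha ht, ρ, hρ, by rw [smul_smul]⟩

lemma InSepCone.add {τ τ' : Matrix (Fin 2 × Fin 2) (Fin 2 × Fin 2) ℂ} (h : InSepCone τ)
    (h' : InSepCone τ') : InSepCone (τ + τ') := by
  obtain ⟨t, ht, ρ, hρ, rfl⟩ := h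
  obtain ⟨t', ht', ρ', hρ', rfl⟩ := h'
  rcases (add_nonneg ht ht').eq_or_lt with h0 | h0
  · exact ⟨0, le_rfl, ρ, hρ, by
      rw [show t = 0 by linarith, show t' = 0 by linarith]; simp⟩
  · refine ⟨t + t', h0.le, (t / (t + t')) • ρ + (t' / (t + t')) • ρ',
      convex_convexHull ℝ _ hρ hρ' (by positivity) (by positivity) (by field_simp), ?_⟩
    rw [smul_add, smul_smul, smul_smul, mul_div_cancel₀ _ h0.ne', mul_div_cancel₀ _ h0.ne']

lemma exists_isDensity_smul {α : Matrix (Fin 2) (Fin 2) ℂ} (hα : α.PosSemidef) :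
    ∃ t : ℝ, 0 ≤ t ∧ ∃ α', IsDensity α' ∧ α = t • α' := by
  have ht : α.trace = (α.trace.re : ℂ) :=
    Complex.ext rfl (Complex.nonneg_iff.mp hα.trace_nonneg).2.symm
  have ht0 := (Complex.nonneg_iff.mp hα.trace_nonneg).1
  rcases ht0.eq_or_lt with h0 | h0
  · refine ⟨0, le_rfl, diagonal ![1, 0], ⟨PosSemidef.diagonal ?_, by simp⟩, ?_⟩
    · intro i; fin_cases i <;> simp
    · rw [zero_smul, ← hα.trace_eq_zero_iff, ht, ← h0, Complex.ofReal_zero]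
  · refine ⟨α.trace.re, h0.le, α.trace.re⁻¹ • α, ⟨hα.smul (by positivity), ?_⟩, ?_⟩
    · rw [trace_smul, ht, Complex.real_smul]
      simp [h0.ne']
    · rw [smul_smul, mul_inv_cancel₀ h0.ne', one_smul]

lemma inSepCone_kronecker {α β : Matrix (Fin 2) (Fin 2) ℂ} (hα : α.PosSemidef)
    (hβ : β.PosSemidef) : InSepCone (α ⊗ₖ β) := by
  obtain ⟨s, hs, α', hα', rfl⟩ := exists_isDensity_smul hα
  obtain ⟨t, ht, β', hβ', rfl⟩ := exists_isDensity_smul hβ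
  refine ⟨s * t, mul_nonneg hs ht, α' ⊗ₖ β', subset_convexHull ℝ _ ⟨α', β', hα', hβ', rfl⟩, ?_⟩
  rw [smul_kronecker, kronecker_smul, smul_smul]

lemma IsSeparable.trace_eq_one {ρ : Matrix (Fin 2 × Fin 2) (Fin 2 × Fin 2) ℂ}
    (hρ : IsSeparable ρ) : ρ.trace = 1 := by
  refine convexHull_min (t := traceLinearMap (Fin 2 × Fin 2) ℝ ℂ ⁻¹' {1}) ?_
    ((convex_singleton _).linear_preimage _) hρ
  rintro _ ⟨α, β, hα, hβ, rfl⟩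
  simp [trace_kronecker, hα.2, hβ.2]

lemma InSepCone.isSeparable {τ : Matrix (Fin 2 × Fin 2) (Fin 2 × Fin 2) ℂ} (h : InSepCone τ)
    (hτ : τ.trace = 1) : IsSeparable τ := by
  obtain ⟨t, ht, ρ, hρ, rfl⟩ := h
  rw [trace_smul, hρ.trace_eq_one, Complex.real_smul, mul_one, Complex.ofReal_eq_one] at hτ
  rwa [hτ, one_smul]

lemma inSepCone_xState_diagonal {d : Fin 4 → ℝ} (hd : ∀ i, 0 ≤ d i) :
    InSepCone (xState d 0 0) := by
  have h0 : (diagonal ![1, 0] : Matrix (Fin 2) (Fin 2) ℂ).PosSemidef :=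
    PosSemidef.diagonal fun i => by fin_cases i <;> simp
  have h1 : (diagonal ![0, 1] : Matrix (Fin 2) (Fin 2) ℂ).PosSemidef :=
    PosSemidef.diagonal fun i => by fin_cases i <;> simp
  convert (((inSepCone_kronecker h0 h0).smul (hd 0)).add
    ((inSepCone_kronecker h0 h1).smul (hd 1))).add
    (((inSepCone_kronecker h1 h0).smul (hd 2)).add
    ((inSepCone_kronecker h1 h1).smul (hd 3))) using 1
  ext ⟨i, j⟩ ⟨k, l⟩
  fin_cases i <;> fin_cases j <;> fin_cases k <;> fin_cases l <;> simp [xState, finProdFinEquiv]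

/-- The equal mixture of `v ⊗ u` and `Zv ⊗ Zu`, with `Z = diag(1, -1)`, is an X-state. -/
lemma inSepCone_xState_of_product (v u : Fin 2 → ℂ) :
    InSepCone (xState ![‖v 0‖ ^ 2 * ‖u 0‖ ^ 2, ‖v 0‖ ^ 2 * ‖u 1‖ ^ 2, ‖v 1‖ ^ 2 * ‖u 0‖ ^ 2,
      ‖v 1‖ ^ 2 * ‖u 1‖ ^ 2] (v 0 * star (v 1) * (u 0 * star (u 1)))
      (v 0 * star (v 1) * (u 1 * star (u 0)))) := by
  have key : ∀ v u : Fin 2 → ℂ, InSepCone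
      (Matrix.of fun x y => v x.1 * star (v y.1) * (u x.2 * star (u y.2))) := fun v u =>
    inSepCone_kronecker (posSemidef_vecMulVec_self_star v)
      (posSemidef_vecMulVec_self_star u)
  have hn : ∀ z : ℂ, (‖z‖ : ℂ) ^ 2 = z * star z := fun z => (Complex.mul_conj' z).symm
  convert ((key v u).smul (a := 1 / 2) (by norm_num)).add
    ((key ![v 0, -v 1] ![u 0, -u 1]).smul (a := 1 / 2) (by norm_num)) using 1
  ext ⟨i, j⟩ ⟨k, l⟩
  fin_cases i <;> fin_cases j <;> fin_cases k <;> fin_cases l <;>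
    simp [xState, finProdFinEquiv, hn] <;> ring

/-- The extreme case: both coherences have the largest modulus that separability allows. -/
lemma inSepCone_xState_sphere {d : Fin 4 → ℝ} (hd : ∀ i, 0 < d i) {m : ℝ} (hm : 0 < m)
    (h03 : d 0 * d 3 = m ^ 2) (h12 : d 1 * d 2 = m ^ 2) {p q : ℂ} (hp : ‖p‖ = m) (hq : ‖q‖ = m) :
    InSepCone (xState d p q) := by
  obtain ⟨e, he⟩ := IsAlgClosed.exists_pow_nat_eq (p * q / m ^ 2) (n := 2) two_pos
  have hmC : (m : ℂ) ≠ 0 := by exact_mod_cast hm.ne'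
  have hnm : ‖(m : ℂ)‖ = m := by simp [abs_of_pos hm]
  have hen : ‖e‖ = 1 := by
    have := congrArg norm he
    rw [norm_pow, norm_div, norm_mul, norm_pow, hp, hq, hnm] at this
    have h1 : ‖e‖ ^ 2 = 1 := by rw [this]; field_simp
    nlinarith [norm_nonneg e]
  have hes : e * star e = 1 := by
    have := Complex.mul_conj' e
    rw [hen] at this
    simpa using this
  have hps : p * star p = m ^ 2 := by
    have := Complex.mul_conj' p
    rw [hp] at this
    simpa using this
  -- The phases `e`, `e'` solve `e e' = p / m` and `e ē' = q / m`.
  set e' : ℂ := p * star e / m with he'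
  have hen' : ‖e'‖ = 1 := by
    rw [he', norm_div, norm_mul, norm_star, hen, hp, hnm]; field_simp
  obtain ⟨b, hb0, hb⟩ : ∃ b : ℝ, 0 ≤ b ∧ b ^ 2 = d 1 / d 0 :=
    ⟨√(d 1 / d 0), Real.sqrt_nonneg _, Real.sq_sqrt (div_nonneg (hd 1).le (hd 0).le)⟩
  have hr : √(d 0) * √(d 2) * b = m := by
    rw [← pow_left_inj₀ (by positivity) hm.le two_ne_zero, mul_pow, mul_pow,
      Real.sq_sqrt (hd 0).le, Real.sq_sqrt (hd 2).le, hb, ← h12]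
    have := (hd 0).ne'
    field_simp
  have hrC : (√(d 0) : ℂ) * √(d 2) * b = m := by exact_mod_cast hr
  convert inSepCone_xState_of_product ![√(d 0) * e, √(d 2)] ![e', b] using 2
  · have h3 : d 3 = d 2 * (d 1 / d 0) := by
      have := (hd 0).ne'
      field_simp
      linarith
    funext i
    fin_cases i <;>
      simp [hen, hen', Real.sq_sqrt, (hd _).le, h3, hb]
    have := (hd 0).ne'
    field_simp
  · simp only [cons_val_zero, cons_val_one]
    have : (√(d 0) : ℂ) * e * star (√(d 2) : ℂ) * (e' * star (b : ℂ)) =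
        (√(d 0) * √(d 2) * b) * (e * e') := by simp; ring
    rw [this, hrC, he']
    have : (m : ℂ) * (e * (p * star e / m)) = p * (e * star e) := by field_simp
    rw [this, hes, mul_one]
  · simp only [cons_val_zero, cons_val_one]
    have : (√(d 0) : ℂ) * e * star (√(d 2) : ℂ) * ((b : ℂ) * star e') =
        (√(d 0) * √(d 2) * b) * (e * star e') := by simp; ring
    rw [this, hrC, he']
    have : (m : ℂ) * (e * star (p * star e / m)) = e ^ 2 * star p := by
      simp; field_simp
    rw [this, he, show p * q / m ^ 2 * star p = q * (p * star p) / m ^ 2 by ring, hps]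
    field_simp

lemma xState_convex_left (d : Fin 4 → ℝ) (q : ℂ) : Convex ℝ {p | InSepCone (xState d p q)} := by
  intro x hx y hy a b ha hb hab
  have hab' : (a : ℂ) + b = 1 := by exact_mod_cast hab
  change InSepCone _
  convert (InSepCone.smul hx ha).add (InSepCone.smul hy hb) using 1
  ext ⟨i, j⟩ ⟨k, l⟩
  fin_cases i <;> fin_cases j <;> fin_cases k <;> fin_cases l <;>
    simp [xState, finProdFinEquiv, ← add_mul, hab']

lemma xState_convex_right (d : Fin 4 → ℝ) (p : ℂ) : Convex ℝ {q | InSepCone (xState d p q)} := by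
  intro x hx y hy a b ha hb hab
  have hab' : (a : ℂ) + b = 1 := by exact_mod_cast hab
  change InSepCone _
  convert (InSepCone.smul hx ha).add (InSepCone.smul hy hb) using 1
  ext ⟨i, j⟩ ⟨k, l⟩
  fin_cases i <;> fin_cases j <;> fin_cases k <;> fin_cases l <;>
    simp [xState, finProdFinEquiv, ← add_mul, hab']

lemma inSepCone_xState_closedBall {d : Fin 4 → ℝ} (hd : ∀ i, 0 < d i) {m : ℝ} (hm : 0 < m)
    (h03 : d 0 * d 3 = m ^ 2) (h12 : d 1 * d 2 = m ^ 2) {p q : ℂ} (hp : ‖p‖ ≤ m) (hq : ‖q‖ ≤ m) :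
    InSepCone (xState d p q) := by
  have h1 : ∀ q : ℂ, ‖q‖ = m → InSepCone (xState d p q) := by
    intro q hq
    have hmem : p ∈ convexHull ℝ (Metric.sphere (0 : ℂ) m) := by
      rw [convexHull_sphere_eq_closedBall _ hm.le]; simpa using hp
    exact convexHull_min (fun x hx => inSepCone_xState_sphere hd hm h03 h12 (by simpa using hx) hq)
      (xState_convex_left d q) hmem
  have hmem : q ∈ convexHull ℝ (Metric.sphere (0 : ℂ) m) := by
    rw [convexHull_sphere_eq_closedBall _ hm.le]; simpa using hq
  exact convexHull_min (fun x hx => h1 x (by simpa using hx)) (xState_convex_right d p) hmem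

lemma inSepCone_xState {d : Fin 4 → ℝ} (hd : ∀ i, 0 ≤ d i) {p q : ℂ} {f g : ℝ} (hf0 : 0 ≤ f)
    (hg0 : 0 ≤ g) (hf : f ^ 2 = d 0 * d 3) (hg : g ^ 2 = d 1 * d 2) (hpf : ‖p‖ ≤ f)
    (hpg : ‖p‖ ≤ g) (hqf : ‖q‖ ≤ f) (hqg : ‖q‖ ≤ g) : InSepCone (xState d p q) := by
  have hpm := le_min hpf hpg
  have hqm := le_min hqf hqg
  rcases (le_min hf0 hg0).eq_or_lt with h0 | h0
  · rw [← h0] at hpm hqm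
    rw [norm_le_zero_iff.mp hpm, norm_le_zero_iff.mp hqm]
    exact inSepCone_xState_diagonal hd
  · set m := min f g
    have hf1 : 0 < f := h0.trans_le (min_le_left _ _)
    have hg1 : 0 < g := h0.trans_le (min_le_right _ _)
    have hd' : ∀ i, 0 < d i := by
      intro i
      refine (hd i).lt_of_ne' fun hi => ?_
      have hf2 := pow_pos hf1 2
      have hg2 := pow_pos hg1 2
      fin_cases i <;> simp at hi <;> simp [hi] at hf hg <;> linarith
    have hmf : m ^ 2 / f ^ 2 ≤ 1 :=
      div_le_one_of_le₀ (pow_le_pow_left₀ h0.le (min_le_left _ _) 2) (by positivity)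
    have hmg : m ^ 2 / g ^ 2 ≤ 1 :=
      div_le_one_of_le₀ (pow_le_pow_left₀ h0.le (min_le_right _ _) 2) (by positivity)
    -- Lowering `d 0` and `d 1` makes both products of opposite diagonal entries equal to `m²`.
    have h1 : InSepCone (xState ![d 0 * (m ^ 2 / f ^ 2), d 1 * (m ^ 2 / g ^ 2), d 2, d 3] p q) := by
      refine inSepCone_xState_closedBall (m := m) ?_ h0 ?_ ?_ hpm hqm
      · have := hd' 0
        have := hd' 1
        intro i
        fin_cases i
        · simp; positivity
        · simp; positivity
        · exact hd' 2
        · exact hd' 3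
      · simp only [cons_val]
        rw [show d 0 * (m ^ 2 / f ^ 2) * d 3 = m ^ 2 / f ^ 2 * (d 0 * d 3) by ring, ← hf]
        field_simp
      · simp only [cons_val]
        rw [show d 1 * (m ^ 2 / g ^ 2) * d 2 = m ^ 2 / g ^ 2 * (d 1 * d 2) by ring, ← hg]
        field_simp
    have h2 : InSepCone
        (xState ![d 0 * (1 - m ^ 2 / f ^ 2), d 1 * (1 - m ^ 2 / g ^ 2), 0, 0] 0 0) := by
      refine inSepCone_xState_diagonal fun i => ?_
      fin_cases i
      · exact mul_nonneg (hd 0) (by linarith)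
      · exact mul_nonneg (hd 1) (by linarith)
      · simp
      · simp
    convert h1.add h2 using 1
    ext ⟨i, j⟩ ⟨k, l⟩
    fin_cases i <;> fin_cases j <;> fin_cases k <;> fin_cases l <;>
      simp [xState, finProdFinEquiv] <;> ring

lemma trace_xState (d : Fin 4 → ℝ) (p q : ℂ) : (xState d p q).trace = ∑ i, (d i : ℂ) := by
  simp [trace, Fintype.sum_prod_type, Fin.sum_univ_four, xState, finProdFinEquiv]
  ring

lemma isSeparable_xState_iff {d : Fin 4 → ℝ} (hd : ∀ i, 0 ≤ d i) (h1 : ∑ i, d i = 1) {p q : ℂ}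
    {f g : ℝ} (hf0 : 0 ≤ f) (hg0 : 0 ≤ g) (hf : f ^ 2 = d 0 * d 3) (hg : g ^ 2 = d 1 * d 2)
    (hpf : ‖p‖ ≤ f) (hqg : ‖q‖ ≤ g) : IsSeparable (xState d p q) ↔ ‖p‖ ≤ g ∧ ‖q‖ ≤ f := by
  refine ⟨le_of_isSeparable_xState hf0 hg0 hf hg, fun ⟨hpg, hqf⟩ => ?_⟩
  refine (inSepCone_xState hd hf0 hg0 hf hg hpf hpg hqf hqg).isSeparable ?_
  rw [trace_xState]
  exact_mod_cast h1

/-! ### Diagonalization of the symmetric matrices -/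

lemma transpose_symMat (v : EuclideanSpace ℂ (Fin 3)) : (symMat v)ᵀ = symMat v := by
  ext i j; fin_cases i <;> fin_cases j <;> simp [symMat]

lemma det_symMat (v : EuclideanSpace ℂ (Fin 3)) : (symMat v).det = -bsq v := by
  simp only [symMat, det_fin_two_of, bsq, Fin.sum_univ_three]
  linear_combination v 1 ^ 2 * Complex.I_sq

lemma trace_symMat_mul_conjTranspose (v : EuclideanSpace ℂ (Fin 3)) :
    (symMat v * (symMat v)ᴴ).trace = 2 * (‖v‖ ^ 2 : ℝ) := by
  rw [EuclideanSpace.norm_sq_eq]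
  simp only [Fin.sum_univ_three, Complex.ofReal_add, Complex.ofReal_pow, ← Complex.mul_conj',
    trace_fin_two, Matrix.mul_apply, Fin.sum_univ_two, conjTranspose_apply]
  simp [symMat]
  linear_combination -2 * v 1 * (starRingEnd ℂ) (v 1) * Complex.I_sq

lemma crossNorm_nonneg (v : EuclideanSpace ℂ (Fin 3)) : 0 ≤ crossNorm v := norm_nonneg _

lemma crossNorm_sq (v : EuclideanSpace ℂ (Fin 3)) :
    crossNorm v ^ 2 = (‖v‖ ^ 2) ^ 2 - ‖bsq v‖ ^ 2 := by
  rw [crossNorm, EuclideanSpace.norm_sq_eq, EuclideanSpace.norm_sq_eq]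
  simp only [Fin.sum_univ_three, ← Complex.normSq_eq_norm_sq, bsq, cross_apply]
  simp [Complex.normSq_apply, pow_two]
  ring

lemma exists_real_unit_orthogonal (w : Fin 3 → ℂ) :
    ∃ n : Fin 3 → ℝ, ∑ k, n k ^ 2 = 1 ∧ 0 ≤ n 2 ∧ ∑ k, (n k : ℂ) * w k = 0 := by
  let f : (Fin 3 → ℝ) →ₗ[ℝ] ℂ :=
    { toFun := fun n => ∑ k, (n k : ℂ) * w k
      map_add' := fun x y => by simp [add_mul, Finset.sum_add_distrib]
      map_smul' := fun c x => by simp [Finset.mul_sum, mul_assoc] }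
  obtain ⟨n, hn, hn0⟩ := Submodule.exists_mem_ne_zero_of_ne_bot
    (LinearMap.ker_ne_bot_of_finrank_lt (f := f) (by simp))
  have hn' : ∑ k, (n k : ℂ) * w k = 0 := hn
  have hpos : 0 < ∑ k, n k ^ 2 := by
    refine lt_of_le_of_ne (Finset.sum_nonneg fun k _ => sq_nonneg _) fun h => hn0 ?_
    funext k
    simpa using (Finset.sum_eq_zero_iff_of_nonneg fun k _ => sq_nonneg _).mp h.symm k
      (Finset.mem_univ k)
  have hs : (√(∑ k, n k ^ 2)) ^ 2 = ∑ k, n k ^ 2 := Real.sq_sqrt hpos.le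
  have key : ∀ c : ℝ, c ^ 2 * ∑ k, n k ^ 2 = 1 → 0 ≤ c * n 2 →
      ∃ n : Fin 3 → ℝ, ∑ k, n k ^ 2 = 1 ∧ 0 ≤ n 2 ∧ ∑ k, (n k : ℂ) * w k = 0 := by
    refine fun c h1 h2 => ⟨fun k => c * n k, by simpa [mul_pow, Finset.mul_sum] using h1, h2, ?_⟩
    simp only [Complex.ofReal_mul, mul_assoc]
    rw [← Finset.mul_sum, hn', mul_zero]
  -- The sign of `n` is free, so that `0 ≤ n 2` can be arranged.
  rcases le_total 0 (n 2) with h | h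
  · exact key (√(∑ k, n k ^ 2))⁻¹ (by rw [inv_pow, hs, inv_mul_cancel₀ hpos.ne'])
      (mul_nonneg (by positivity) h)
  · exact key (-(√(∑ k, n k ^ 2))⁻¹) (by rw [neg_sq, inv_pow, hs, inv_mul_cancel₀ hpos.ne'])
      (mul_nonneg_of_nonpos_of_nonpos (by simp) h)

/-- A unit vector of `ℂ²` is the first row of an element of `SU(2)`. -/
lemma isSpecialUnitary_of_row {x y : ℂ} (h : x * star x + y * star y = 1) :
    IsSpecialUnitary !![x, y; -star y, star x] := by
  constructor
  · ext i j
    fin_cases i <;> fin_cases j <;> simp [Matrix.mul_apply, Fin.sum_univ_two] <;>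
      simp at h <;> first | linear_combination h | ring
  · ext i j
    fin_cases i <;> fin_cases j <;> simp [Matrix.mul_apply, Fin.sum_univ_two, eps] <;>
      simp at h <;> first | linear_combination h | linear_combination -h | ring

/-- With the rows `(x, y)` and `(-ȳ, x̄)` of `U`, the off-diagonal entries of `U S(w) Uᵀ` are
`-n · w`, where `n = (2 Re x ȳ, 2 Im x ȳ, |x|² - |y|²)` is the Bloch vector of the first row. They
vanish for a real unit vector `n` with `n · w = 0`. -/
lemma exists_isSpecialUnitary_diagonal (w : EuclideanSpace ℂ (Fin 3)) :
    ∃ U, IsSpecialUnitary U ∧ ∃ b : Fin 2 → ℂ, U * symMat w * Uᵀ = diagonal b := by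
  obtain ⟨n, hn1, hn2, hn⟩ := exists_real_unit_orthogonal w
  rw [Fin.sum_univ_three] at hn1 hn
  -- The row `(a, y)` with Bloch vector `n`; `0 ≤ n 2` keeps `a` away from zero.
  obtain ⟨a, ha0, ha⟩ : ∃ a : ℝ, 0 < a ∧ 2 * a ^ 2 = 1 + n 2 :=
    ⟨√((1 + n 2) / 2), by positivity, by rw [Real.sq_sqrt (by positivity)]; ring⟩
  have haC : 2 * (a : ℂ) ^ 2 = 1 + n 2 := by exact_mod_cast ha
  have hn1C : (n 0 : ℂ) ^ 2 + n 1 ^ 2 + n 2 ^ 2 = 1 := by exact_mod_cast hn1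
  have ha0C : (a : ℂ) ≠ 0 := by exact_mod_cast ha0.ne'
  set y : ℂ := (n 0 - Complex.I * n 1) / (2 * a) with hy
  have hys : star y = (n 0 + Complex.I * n 1) / (2 * a) := by simp [hy]
  have hay : 2 * a * y = n 0 - Complex.I * n 1 := by rw [hy]; field_simp
  have hays : 2 * a * star y = n 0 + Complex.I * n 1 := by rw [hys]; field_simp
  have hyy : 2 * (y * star y) = 1 - n 2 := by
    have h4 : (4 * (a : ℂ) ^ 2) ≠ 0 := by positivity
    apply mul_left_cancel₀ h4
    linear_combination 2 * (2 * a * star y) * hay + 2 * (n 0 - Complex.I * n 1) * hays -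
      2 * (1 - n 2) * haC - 2 * n 1 ^ 2 * Complex.I_sq + 2 * hn1C
  have hU : IsSpecialUnitary !![(a : ℂ), y; -star y, star (a : ℂ)] := by
    apply isSpecialUnitary_of_row
    have : star (a : ℂ) = a := by simp
    rw [this]
    linear_combination (1 / 2 : ℂ) * haC + (1 / 2 : ℂ) * hyy
  refine ⟨_, hU, ![(!![(a : ℂ), y; -star y, star (a : ℂ)] * symMat w *
    !![(a : ℂ), y; -star y, star (a : ℂ)]ᵀ) 0 0, (!![(a : ℂ), y; -star y, star (a : ℂ)] * symMat w *
    !![(a : ℂ), y; -star y, star (a : ℂ)]ᵀ) 1 1], ?_⟩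
  have hoff : -(w 0 - Complex.I * w 1) * (a * star y) - w 2 * (a * a - y * star y) +
      (-w 0 - Complex.I * w 1) * (a * y) = 0 := by
    linear_combination -(1 / 2 : ℂ) * (w 0 - Complex.I * w 1) * hays
      - (1 / 2 : ℂ) * (w 0 + Complex.I * w 1) * hay
      - (1 / 2 : ℂ) * w 2 * haC + (1 / 2 : ℂ) * w 2 * hyy - hn + n 1 * w 1 * Complex.I_sq
  ext i j
  fin_cases i <;> fin_cases j
  · simp
  · simp [Matrix.mul_apply, Fin.sum_univ_two, symMat]
    simp at hoff
    linear_combination hoff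
  · simp [Matrix.mul_apply, Fin.sum_univ_two, symMat]
    simp at hoff
    linear_combination hoff
  · simp

/-- The normal form of `S(w)` under `S ↦ U S Uᵀ`, together with the invariants `tr S Sᴴ` and
`det S` expressed by its diagonal entries. -/
lemma exists_isSpecialUnitary_canonical (w : EuclideanSpace ℂ (Fin 3)) :
    ∃ U, IsSpecialUnitary U ∧ ∃ b : Fin 2 → ℂ, U * symMat w * Uᵀ = diagonal b ∧
      ‖b 0‖ ^ 2 + ‖b 1‖ ^ 2 = 2 * ‖w‖ ^ 2 ∧ b 0 * b 1 = -bsq w ∧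
      crossNorm w = |(‖b 0‖ ^ 2 - ‖b 1‖ ^ 2) / 2| := by
  obtain ⟨U, hU, b, hb⟩ := exists_isSpecialUnitary_diagonal w
  have hUU : Uᴴ * U = 1 := mul_eq_one_comm.mp hU.1
  have hT : Uᵀ * Uᵀᴴ = 1 := by
    have := congrArg Matrix.transpose hUU
    rw [transpose_mul, transpose_one] at this
    exact this
  have hdetU : U.det * U.det = 1 := by
    have := congrArg Matrix.det hU.2
    simpa [det_mul, eps, det_fin_two_of] using this
  have htr : ‖b 0‖ ^ 2 + ‖b 1‖ ^ 2 = 2 * ‖w‖ ^ 2 := by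
    have h1 : (U * symMat w * Uᵀ) * (U * symMat w * Uᵀ)ᴴ = U * (symMat w * (symMat w)ᴴ) * Uᴴ := by
      rw [conjTranspose_mul, conjTranspose_mul]
      calc _ = U * symMat w * (Uᵀ * Uᵀᴴ) * (symMat w)ᴴ * Uᴴ := by simp only [Matrix.mul_assoc]
        _ = _ := by rw [hT, Matrix.mul_one]; simp only [Matrix.mul_assoc]
    have h2 := congrArg trace h1
    rw [hb, trace_mul_comm (U * _), ← Matrix.mul_assoc, hUU, Matrix.one_mul,
      trace_symMat_mul_conjTranspose] at h2
    have h3 : (b 0 * star (b 0) + b 1 * star (b 1)) = 2 * (‖w‖ ^ 2 : ℝ) := by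
      rw [← h2]; simp [diagonal_conjTranspose]
    rw [show b 0 * star (b 0) = _ from Complex.mul_conj' _,
      show b 1 * star (b 1) = _ from Complex.mul_conj' _] at h3
    exact_mod_cast h3
  have hdet : b 0 * b 1 = -bsq w := by
    have := congrArg Matrix.det hb
    rw [det_mul, det_mul, det_transpose, det_symMat, det_diagonal, Fin.prod_univ_two] at this
    rw [← this]
    linear_combination -bsq w * hdetU
  refine ⟨U, hU, b, hb, htr, hdet, ?_⟩
  rw [← abs_of_nonneg (crossNorm_nonneg w), ← sq_eq_sq_iff_abs_eq_abs, crossNorm_sq]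
  have hn := congrArg norm hdet
  rw [norm_mul, norm_neg] at hn
  rw [← hn, show ‖w‖ ^ 2 = (‖b 0‖ ^ 2 + ‖b 1‖ ^ 2) / 2 by linarith]
  ring

/-! ### The reduced states across the pairs 12|34 and 14|23 -/

/-- The matrix `½ (ε ⊗ A + B ⊗ ε)` of the amplitudes `ψ^{ijkl}` with row `ij` and column `kl`. -/
noncomputable def amplitude (A B : Matrix (Fin 2) (Fin 2) ℂ) :
    Matrix (Fin 2 × Fin 2) (Fin 2 × Fin 2) ℂ :=
  (1 / 2 : ℂ) • (eps ⊗ₖ A + B ⊗ₖ eps)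

lemma amplitude_apply (A B : Matrix (Fin 2) (Fin 2) ℂ) (x y : Fin 2 × Fin 2) :
    amplitude A B x y = 1 / 2 * (eps x.1 y.1 * A x.2 y.2 + B x.1 y.1 * eps x.2 y.2) := rfl

lemma amplitude_congr {U V : Matrix (Fin 2) (Fin 2) ℂ} (hU : IsSpecialUnitary U)
    (hV : IsSpecialUnitary V) (A B : Matrix (Fin 2) (Fin 2) ℂ) :
    amplitude (V * A * Vᵀ) (U * B * Uᵀ) = (U ⊗ₖ V) * amplitude A B * (U ⊗ₖ V)ᵀ := by
  rw [amplitude, amplitude, Matrix.mul_smul, Matrix.smul_mul, Matrix.mul_add, Matrix.add_mul,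
    ← kroneckerMap_transpose, ← mul_kronecker_mul, ← mul_kronecker_mul, ← mul_kronecker_mul,
    ← mul_kronecker_mul, hU.2, hV.2]

lemma amplitude_mul_conjTranspose_congr {U V : Matrix (Fin 2) (Fin 2) ℂ} (hU : IsSpecialUnitary U)
    (hV : IsSpecialUnitary V) (A B : Matrix (Fin 2) (Fin 2) ℂ) :
    amplitude (V * A * Vᵀ) (U * B * Uᵀ) * (amplitude (V * A * Vᵀ) (U * B * Uᵀ))ᴴ =
      (U ⊗ₖ V) * (amplitude A B * (amplitude A B)ᴴ) * (U ⊗ₖ V)ᴴ := by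
  rw [amplitude_congr hU hV]
  have h := congrArg Matrix.transpose (kronecker_isometry hU hV)
  rw [transpose_mul, transpose_one] at h
  generalize U ⊗ₖ V = L at *
  have h : Lᵀ * Lᵀᴴ = 1 := h
  rw [conjTranspose_mul, conjTranspose_mul]
  calc _ = L * amplitude A B * (Lᵀ * Lᵀᴴ) * (amplitude A B)ᴴ * Lᴴ := by
        simp only [Matrix.mul_assoc]
    _ = _ := by rw [h, Matrix.mul_one]; simp only [Matrix.mul_assoc]

lemma amplitude_diagonal_mul_conjTranspose (a b : Fin 2 → ℂ) :
    amplitude (diagonal a) (diagonal b) * (amplitude (diagonal a) (diagonal b))ᴴ =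
      xState ![(‖b 0‖ ^ 2 + ‖a 0‖ ^ 2) / 4, (‖b 0‖ ^ 2 + ‖a 1‖ ^ 2) / 4,
        (‖b 1‖ ^ 2 + ‖a 0‖ ^ 2) / 4, (‖b 1‖ ^ 2 + ‖a 1‖ ^ 2) / 4]
        (-(b 0 * star (a 1) + a 0 * star (b 1)) / 4)
        ((b 0 * star (a 0) + a 1 * star (b 1)) / 4) := by
  have hn : ∀ z : ℂ, (‖z‖ : ℂ) ^ 2 = z * star z := fun z => (Complex.mul_conj' z).symm
  ext ⟨i, j⟩ ⟨k, l⟩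
  fin_cases i <;> fin_cases j <;> fin_cases k <;> fin_cases l <;>
    simp [amplitude, xState, finProdFinEquiv, eps, Matrix.mul_apply, Fintype.sum_prod_type, hn] <;>
    ring

/-- For `f, g, P = |p|, Q = |q|` of an X-state, expressed by `R`, `S` of either sign: the sign of
`R S` decides which of the two coherences can violate separability. -/
lemma xState_bounds {η r s R S f g P Q : ℝ} (hf : 0 ≤ f) (hg : 0 ≤ g) (hP : 0 ≤ P) (hQ : 0 ≤ Q)
    (hr : r = |R|) (hs : s = |S|) (hf2 : 16 * f ^ 2 = 1 - (R + S) ^ 2)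
    (hg2 : 16 * g ^ 2 = 1 - (R - S) ^ 2) (hP2 : 16 * P ^ 2 = 1 - (R + S) ^ 2 - η ^ 2)
    (hQ2 : 16 * Q ^ 2 = 1 - (R - S) ^ 2 - η ^ 2) :
    2 * max 0 (max (P - g) (Q - f)) =
      1 / 2 * max 0 (√(1 - η ^ 2 - (r - s) ^ 2) - √(1 - (r + s) ^ 2)) ∧
    ((P ≤ g ∧ Q ≤ f) ↔ 4 * r * s ≤ η ^ 2) := by
  have hrr : r ^ 2 = R ^ 2 := by rw [hr, sq_abs]
  have hss : s ^ 2 = S ^ 2 := by rw [hs, sq_abs]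
  have hrs : r * s = |R * S| := by rw [hr, hs, abs_mul]
  have hη := sq_nonneg η
  have hroot : ∀ {x y : ℝ}, 0 ≤ x → y = 16 * x ^ 2 → √y = 4 * x := fun {x y} hx hy => by
    rw [hy, show 16 * x ^ 2 = (4 * x) ^ 2 by ring, Real.sqrt_sq (by positivity)]
  have hmax : ∀ {x y : ℝ}, 2 * max 0 (x - y) = 1 / 2 * max 0 (4 * x - 4 * y) := fun {x y} => by
    rw [mul_max_of_nonneg _ _ (by norm_num), mul_max_of_nonneg _ _ (by norm_num)]
    ring_nf
  rcases le_total 0 (R * S) with h | h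
  · rw [abs_of_nonneg h] at hrs
    have hPg : P ≤ g := by rw [← pow_le_pow_iff_left₀ hP hg two_ne_zero]; linarith
    rw [hroot hQ (by linarith), hroot hf (by linarith)]
    refine ⟨?_, ?_⟩
    · rw [← hmax, ← max_assoc, max_eq_left (b := P - g) (by linarith)]
    · rw [and_iff_right hPg, ← pow_le_pow_iff_left₀ hQ hf two_ne_zero]
      constructor <;> intro <;> linarith
  · rw [abs_of_nonpos h] at hrs
    have hQf : Q ≤ f := by rw [← pow_le_pow_iff_left₀ hQ hf two_ne_zero]; linarith
    rw [hroot hP (by linarith), hroot hg (by linarith)]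
    refine ⟨?_, ?_⟩
    · rw [← hmax, max_comm (P - g), ← max_assoc, max_eq_left (b := Q - f) (by linarith)]
    · rw [and_iff_left hQf, ← pow_le_pow_iff_left₀ hP hg two_ne_zero]
      constructor <;> intro <;> linarith

theorem concurrence_isSeparable_amplitude (w z : EuclideanSpace ℂ (Fin 3))
    (hwz : ‖w‖ ^ 2 + ‖z‖ ^ 2 = 1) {ρ : Matrix (Fin 2 × Fin 2) (Fin 2 × Fin 2) ℂ}
    (hρ : ρ = amplitude (symMat z) (symMat w) * (amplitude (symMat z) (symMat w))ᴴ) :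
    concurrence ρ = 1 / 2 * max 0 (√(1 - eta w z ^ 2 - (crossNorm w - crossNorm z) ^ 2) -
      √(1 - (crossNorm w + crossNorm z) ^ 2)) ∧
    (IsSeparable ρ ↔ 4 * crossNorm w * crossNorm z ≤ eta w z ^ 2) := by
  obtain ⟨U, hU, b, hb, hbn, hbb, hr⟩ := exists_isSpecialUnitary_canonical w
  obtain ⟨V, hV, a, ha, han, haa, hs⟩ := exists_isSpecialUnitary_canonical z
  have hpsd : ρ.PosSemidef := hρ ▸ posSemidef_self_mul_conjTranspose _
  have hX := amplitude_mul_conjTranspose_congr hU hV (symMat z) (symMat w)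
  rw [ha, hb, amplitude_diagonal_mul_conjTranspose, ← hρ] at hX
  rw [← concurrence_conj hU hV hpsd, ← isSeparable_conj_iff hU hV, ← hX]
  have hpsd' := hpsd.mul_mul_conjTranspose_same (U ⊗ₖ V)
  rw [← hX] at hpsd'
  have hη : eta w z ^ 2 = ‖b 0 * b 1 - a 0 * a 1‖ ^ 2 := by
    rw [hbb, haa, eta, ← norm_neg]; ring_nf
  have hp2 : 16 * ‖-(b 0 * star (a 1) + a 0 * star (b 1)) / 4‖ ^ 2 =
      (‖b 0‖ ^ 2 + ‖a 0‖ ^ 2) * (‖b 1‖ ^ 2 + ‖a 1‖ ^ 2) - eta w z ^ 2 := by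
    rw [hη]
    simp only [← Complex.normSq_eq_norm_sq]
    simp [Complex.normSq_apply]
    ring
  have hq2 : 16 * ‖(b 0 * star (a 0) + a 1 * star (b 1)) / 4‖ ^ 2 =
      (‖b 0‖ ^ 2 + ‖a 1‖ ^ 2) * (‖b 1‖ ^ 2 + ‖a 0‖ ^ 2) - eta w z ^ 2 := by
    rw [hη]
    simp only [← Complex.normSq_eq_norm_sq]
    simp [Complex.normSq_apply]
    ring
  generalize -(b 0 * star (a 1) + a 0 * star (b 1)) / 4 = p at *
  generalize (b 0 * star (a 0) + a 1 * star (b 1)) / 4 = q at *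
  have hβ0 := sq_nonneg ‖b 0‖
  have hβ1 := sq_nonneg ‖b 1‖
  have hα0 := sq_nonneg ‖a 0‖
  have hα1 := sq_nonneg ‖a 1‖
  generalize ‖b 0‖ ^ 2 = β0 at *
  generalize ‖b 1‖ ^ 2 = β1 at *
  generalize ‖a 0‖ ^ 2 = α0 at *
  generalize ‖a 1‖ ^ 2 = α1 at *
  obtain ⟨f, hf0, hf⟩ : ∃ f : ℝ, 0 ≤ f ∧ 16 * f ^ 2 = (β0 + α0) * (β1 + α1) :=
    ⟨√((β0 + α0) * (β1 + α1) / 16), Real.sqrt_nonneg _, by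
      rw [Real.sq_sqrt (by positivity)]; ring⟩
  obtain ⟨g, hg0, hg⟩ : ∃ g : ℝ, 0 ≤ g ∧ 16 * g ^ 2 = (β0 + α1) * (β1 + α0) :=
    ⟨√((β0 + α1) * (β1 + α0) / 16), Real.sqrt_nonneg _, by
      rw [Real.sq_sqrt (by positivity)]; ring⟩
  have hsum : β0 + β1 + α0 + α1 = 2 := by linarith
  have hη0 := sq_nonneg (eta w z)
  have hpf : ‖p‖ ≤ f := by
    rw [← pow_le_pow_iff_left₀ (norm_nonneg _) hf0 two_ne_zero]; linarith
  have hqg : ‖q‖ ≤ g := by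
    rw [← pow_le_pow_iff_left₀ (norm_nonneg _) hg0 two_ne_zero]; linarith
  have hfd : f ^ 2 = (β0 + α0) / 4 * ((β1 + α1) / 4) := by linarith
  have hgd : g ^ 2 = (β0 + α1) / 4 * ((β1 + α0) / 4) := by linarith
  have hf2 : 16 * f ^ 2 = 1 - ((β0 - β1) / 2 + (α0 - α1) / 2) ^ 2 := by
    rw [hf]; linear_combination ((β0 + β1 + α0 + α1) / 4 + 1 / 2) * hsum
  have hg2 : 16 * g ^ 2 = 1 - ((β0 - β1) / 2 - (α0 - α1) / 2) ^ 2 := by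
    rw [hg]; linear_combination ((β0 + β1 + α0 + α1) / 4 + 1 / 2) * hsum
  obtain ⟨h1, h2⟩ := xState_bounds (P := ‖p‖) (Q := ‖q‖) hf0 hg0 (norm_nonneg _) (norm_nonneg _)
    hr hs hf2 hg2 (by rw [hp2, ← hf2, hf]) (by rw [hq2, ← hg2, hg])
  rw [← h1, ← h2]
  refine ⟨concurrence_xState hpsd' hfd hgd hpf hqg,
    isSeparable_xState_iff (fun i => ?_) ?_ hf0 hg0 hfd hgd hpf hqg⟩
  · fin_cases i <;> simp <;> positivity
  · simp [Fin.sum_univ_four]; linarith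

/-! ### The reduced states of the pairs 13 and 24 -/

/-- The operator `½ (t |ε⟩⟨ε| + |B⟩⟨B|)`, where the 2 × 2 matrices `ε` and `B` are read as vectors
with components `ε^{ij}` and `B^{ij}`; `|ε⟩` is proportional to the singlet. -/
noncomputable def singletMixture (t : ℝ) (B : Matrix (Fin 2) (Fin 2) ℂ) :
    Matrix (Fin 2 × Fin 2) (Fin 2 × Fin 2) ℂ :=
  Matrix.of fun x y => 1 / 2 * (t * (eps x.1 x.2 * star (eps y.1 y.2)) +
    B x.1 x.2 * star (B y.1 y.2))

lemma singletMixture_eq (t : ℝ) (B : Matrix (Fin 2) (Fin 2) ℂ) : singletMixture t B =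
    (1 / 2 : ℂ) • ((t : ℂ) • vecMulVec (fun x => eps x.1 x.2) (star fun x => eps x.1 x.2) +
      vecMulVec (fun x => B x.1 x.2) (star fun x => B x.1 x.2)) := by
  ext x y
  simp [singletMixture, vecMulVec_apply]

lemma posSemidef_singletMixture {t : ℝ} (ht : 0 ≤ t) (B : Matrix (Fin 2) (Fin 2) ℂ) :
    (singletMixture t B).PosSemidef := by
  rw [singletMixture_eq]
  exact (((posSemidef_vecMulVec_self_star _).smul (Complex.zero_le_real.mpr ht)).add
    (posSemidef_vecMulVec_self_star _)).smul (by norm_num [Complex.le_def])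

lemma singletMixture_congr {U : Matrix (Fin 2) (Fin 2) ℂ} (hU : IsSpecialUnitary U) (t : ℝ)
    (B : Matrix (Fin 2) (Fin 2) ℂ) :
    singletMixture t (U * B * Uᵀ) = (U ⊗ₖ U) * singletMixture t B * (U ⊗ₖ U)ᴴ := by
  have hv : ∀ (A : Matrix (Fin 2) (Fin 2) ℂ) (x : Fin 2 × Fin 2),
      (U * A * Uᵀ) x.1 x.2 = ((U ⊗ₖ U) *ᵥ fun y => A y.1 y.2) x := by
    intro A x
    simp [Matrix.mul_apply, mulVec, dotProduct, Fintype.sum_prod_type, Fin.sum_univ_two]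
    ring
  have hvv : ∀ v : Fin 2 × Fin 2 → ℂ, (U ⊗ₖ U) * vecMulVec v (star v) * (U ⊗ₖ U)ᴴ =
      vecMulVec ((U ⊗ₖ U) *ᵥ v) (star ((U ⊗ₖ U) *ᵥ v)) := by
    intro v
    rw [mul_vecMulVec, vecMulVec_mul, star_mulVec]
  rw [singletMixture_eq, singletMixture_eq, Matrix.mul_smul, Matrix.smul_mul, Matrix.mul_add,
    Matrix.add_mul, Matrix.mul_smul, Matrix.smul_mul, hvv, hvv, ← funext (hv B), ← funext (hv eps), hU.2]

lemma singletMixture_diagonal (t : ℝ) (b : Fin 2 → ℂ) :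
    singletMixture t (diagonal b) =
      xState ![‖b 0‖ ^ 2 / 2, t / 2, t / 2, ‖b 1‖ ^ 2 / 2] (b 0 * star (b 1) / 2) (-t / 2) := by
  have hn : ∀ z : ℂ, (‖z‖ : ℂ) ^ 2 = z * star z := fun z => (Complex.mul_conj' z).symm
  ext ⟨i, j⟩ ⟨k, l⟩
  fin_cases i <;> fin_cases j <;> fin_cases k <;> fin_cases l <;>
    simp [singletMixture, xState, finProdFinEquiv, eps, hn] <;> ring

theorem concurrence_singletMixture {t : ℝ} (ht : 0 ≤ t) (w : EuclideanSpace ℂ (Fin 3)) :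
    concurrence (singletMixture t (symMat w)) = |t - ‖bsq w‖| := by
  have hpsd := posSemidef_singletMixture ht (symMat w)
  obtain ⟨U, hU, b, hb, -, hbb, -⟩ := exists_isSpecialUnitary_canonical w
  have hX := singletMixture_congr hU t (symMat w)
  rw [hb, singletMixture_diagonal] at hX
  rw [← concurrence_conj hU hU hpsd, ← hX]
  have hpsd' := hpsd.mul_mul_conjTranspose_same (U ⊗ₖ U)
  rw [← hX] at hpsd'
  have hn := congrArg norm hbb
  rw [norm_mul, norm_neg] at hn
  have hp : ‖b 0 * star (b 1) / 2‖ = ‖bsq w‖ / 2 := by simp [← hn]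
  have hq : ‖(-t / 2 : ℂ)‖ = t / 2 := by simp [abs_of_nonneg ht]
  rw [concurrence_xState (f := ‖bsq w‖ / 2) (g := t / 2) hpsd' ?_ ?_ hp.le hq.le, hp, hq]
  · rcases le_total t ‖bsq w‖ with h | h
    · rw [abs_of_nonpos (by linarith), max_eq_left (b := t / 2 - _) (by linarith),
        max_eq_right (by linarith)]
      ring
    · rw [abs_of_nonneg (by linarith), max_eq_right (b := t / 2 - _) (by linarith),
        max_eq_right (by linarith)]
      ring
  · simp [← hn]; ring
  · simp; ring

/-! ### Sums over the basis of the four qubits -/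

lemma sum_qubits {M : Type*} [AddCommMonoid M] (F : (Fin 4 → Fin 2) → M) :
    ∑ x, F x = ∑ i, ∑ j, ∑ k, ∑ l, F ![i, j, k, l] := by
  rw [← (Fin.consEquiv fun _ => Fin 2).sum_comp, Fintype.sum_prod_type]
  refine Finset.sum_congr rfl fun i _ => ?_
  rw [← (Fin.consEquiv fun _ => Fin 2).sum_comp, Fintype.sum_prod_type]
  refine Finset.sum_congr rfl fun j _ => ?_
  rw [← (Fin.consEquiv fun _ => Fin 2).sum_comp, Fintype.sum_prod_type]
  refine Finset.sum_congr rfl fun k _ => ?_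
  rw [← (Fin.consEquiv fun _ => Fin 2).sum_comp, Fintype.sum_prod_type]
  refine Finset.sum_congr rfl fun l _ => ?_
  rw [Fintype.sum_unique]
  congr 1

section reduced
variable (ψ : Ket)

lemma reduced2_swap {a b : Fin 4} (h : a ≠ b) :
    reduced2 ψ b a = (reduced2 ψ a b).submatrix Prod.swap Prod.swap := by
  ext p q
  simp only [reduced2, submatrix_apply, Matrix.of_apply, Prod.fst_swap, Prod.snd_swap]
  refine Finset.sum_congr rfl fun x _ => ?_
  rw [Function.update_comm h]
  simp only [and_comm]

lemma reduced2_zero_one (p q : Fin 2 × Fin 2) : reduced2 ψ 0 1 p q =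
    ∑ k, ∑ l, ψ ![p.1, p.2, k, l] * star (ψ ![q.1, q.2, k, l]) := by
  have h : ∀ i j k l : Fin 2, Function.update (Function.update ![i, j, k, l] 0 q.1) 1 q.2 =
      ![q.1, q.2, k, l] := fun i j k l => by funext a; fin_cases a <;> rfl
  obtain ⟨p, p'⟩ := p
  fin_cases p <;> fin_cases p' <;> simp [reduced2, proj, sum_qubits, h, add_assoc]

lemma reduced2_zero_three (p q : Fin 2 × Fin 2) : reduced2 ψ 0 3 p q =
    ∑ j, ∑ k, ψ ![p.1, j, k, p.2] * star (ψ ![q.1, j, k, q.2]) := by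
  have h : ∀ i j k l : Fin 2, Function.update (Function.update ![i, j, k, l] 0 q.1) 3 q.2 =
      ![q.1, j, k, q.2] := fun i j k l => by funext a; fin_cases a <;> rfl
  obtain ⟨p, p'⟩ := p
  fin_cases p <;> fin_cases p' <;> simp [reduced2, proj, sum_qubits, h, add_assoc]

lemma reduced2_one_two (p q : Fin 2 × Fin 2) : reduced2 ψ 1 2 p q =
    ∑ i, ∑ l, ψ ![i, p.1, p.2, l] * star (ψ ![i, q.1, q.2, l]) := by
  have h : ∀ i j k l : Fin 2, Function.update (Function.update ![i, j, k, l] 1 q.1) 2 q.2 =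
      ![i, q.1, q.2, l] := fun i j k l => by funext a; fin_cases a <;> rfl
  obtain ⟨p, p'⟩ := p
  fin_cases p <;> fin_cases p' <;> simp [reduced2, proj, sum_qubits, h, add_assoc]

lemma reduced2_two_three (p q : Fin 2 × Fin 2) : reduced2 ψ 2 3 p q =
    ∑ i, ∑ j, ψ ![i, j, p.1, p.2] * star (ψ ![i, j, q.1, q.2]) := by
  have h : ∀ i j k l : Fin 2, Function.update (Function.update ![i, j, k, l] 2 q.1) 3 q.2 =
      ![i, j, q.1, q.2] := fun i j k l => by funext a; fin_cases a <;> rfl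
  obtain ⟨p, p'⟩ := p
  fin_cases p <;> fin_cases p' <;> simp [reduced2, proj, sum_qubits, h, add_assoc]

lemma reduced2_zero_two (p q : Fin 2 × Fin 2) : reduced2 ψ 0 2 p q =
    ∑ j, ∑ l, ψ ![p.1, j, p.2, l] * star (ψ ![q.1, j, q.2, l]) := by
  have h : ∀ i j k l : Fin 2, Function.update (Function.update ![i, j, k, l] 0 q.1) 2 q.2 =
      ![q.1, j, q.2, l] := fun i j k l => by funext a; fin_cases a <;> rfl
  obtain ⟨p, p'⟩ := p
  fin_cases p <;> fin_cases p' <;> simp [reduced2, proj, sum_qubits, h, add_assoc]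

lemma reduced2_one_three (p q : Fin 2 × Fin 2) : reduced2 ψ 1 3 p q =
    ∑ i, ∑ k, ψ ![i, p.1, k, p.2] * star (ψ ![i, q.1, k, q.2]) := by
  have h : ∀ i j k l : Fin 2, Function.update (Function.update ![i, j, k, l] 1 q.1) 3 q.2 =
      ![i, q.1, k, q.2] := fun i j k l => by funext a; fin_cases a <;> rfl
  obtain ⟨p, p'⟩ := p
  fin_cases p <;> fin_cases p' <;> simp [reduced2, proj, sum_qubits, h, add_assoc]

lemma reduced1_zero (p q : Fin 2) : reduced1 ψ 0 p q =
    ∑ j, ∑ k, ∑ l, ψ ![p, j, k, l] * star (ψ ![q, j, k, l]) := by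
  have h : ∀ i j k l : Fin 2, Function.update ![i, j, k, l] 0 q = ![q, j, k, l] :=
    fun i j k l => by funext a; fin_cases a <;> rfl
  fin_cases p <;> simp [reduced1, proj, sum_qubits, h, add_assoc]

lemma reduced1_one (p q : Fin 2) : reduced1 ψ 1 p q =
    ∑ i, ∑ k, ∑ l, ψ ![i, p, k, l] * star (ψ ![i, q, k, l]) := by
  have h : ∀ i j k l : Fin 2, Function.update ![i, j, k, l] 1 q = ![i, q, k, l] :=
    fun i j k l => by funext a; fin_cases a <;> rfl
  fin_cases p <;> simp [reduced1, proj, sum_qubits, h, add_assoc]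

lemma reduced1_two (p q : Fin 2) : reduced1 ψ 2 p q =
    ∑ i, ∑ j, ∑ l, ψ ![i, j, p, l] * star (ψ ![i, j, q, l]) := by
  have h : ∀ i j k l : Fin 2, Function.update ![i, j, k, l] 2 q = ![i, j, q, l] :=
    fun i j k l => by funext a; fin_cases a <;> rfl
  fin_cases p <;> simp [reduced1, proj, sum_qubits, h, add_assoc]

lemma reduced1_three (p q : Fin 2) : reduced1 ψ 3 p q =
    ∑ i, ∑ j, ∑ k, ψ ![i, j, k, p] * star (ψ ![i, j, k, q]) := by
  have h : ∀ i j k l : Fin 2, Function.update ![i, j, k, l] 3 q = ![i, j, k, q] :=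
    fun i j k l => by funext a; fin_cases a <;> rfl
  fin_cases p <;> simp [reduced1, proj, sum_qubits, h, add_assoc]

end reduced

/-! ### The parametrization -/

lemma fermionicState_apply (w z : EuclideanSpace ℂ (Fin 3)) (i j k l : Fin 2) :
    fermionicState w z ![i, j, k, l] =
      1 / 2 * (eps i k * symMat z j l + symMat w i k * eps j l) := rfl

lemma symMat_neg (v : EuclideanSpace ℂ (Fin 3)) : symMat (-v) = -symMat v := by
  ext i j; fin_cases i <;> fin_cases j <;> simp [symMat] <;> ring

lemma symMat_comm (v : EuclideanSpace ℂ (Fin 3)) (i j : Fin 2) : symMat v i j = symMat v j i :=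
  congrFun (congrFun (transpose_symMat v) j) i

lemma eps_antisymm (i j : Fin 2) : eps i j = -eps j i := by
  fin_cases i <;> fin_cases j <;> simp [eps]

lemma ext_ket {ψ φ : Ket} (h : ∀ i j k l, ψ ![i, j, k, l] = φ ![i, j, k, l]) : ψ = φ := by
  ext x
  have : x = ![x 0, x 1, x 2, x 3] := by funext a; fin_cases a <;> rfl
  rw [this]
  exact h _ _ _ _

/-- The components of `z` and `w` are read off from the contractions `ε_{ik} ψ^{ijkl} = S(z)^{jl}`
and `ε_{jl} ψ^{ijkl} = S(w)^{ik}`. -/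
theorem existsUnique_parameters {ψ : Ket} (h : IsAntisymm ψ) :
    ∃! p : EuclideanSpace ℂ (Fin 3) × EuclideanSpace ℂ (Fin 3), ψ = fermionicState p.1 p.2 := by
  refine ⟨(!₂[(ψ ![0, 0, 0, 1] - ψ ![0, 1, 0, 0] - (ψ ![1, 0, 1, 1] - ψ ![1, 1, 1, 0])) / 2,
      Complex.I * (ψ ![0, 0, 0, 1] - ψ ![0, 1, 0, 0] + (ψ ![1, 0, 1, 1] - ψ ![1, 1, 1, 0])) / 2,
      -(ψ ![0, 0, 1, 1] - ψ ![0, 1, 1, 0])],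
    !₂[(ψ ![0, 0, 1, 0] - ψ ![1, 0, 0, 0] - (ψ ![0, 1, 1, 1] - ψ ![1, 1, 0, 1])) / 2,
      Complex.I * (ψ ![0, 0, 1, 0] - ψ ![1, 0, 0, 0] + (ψ ![0, 1, 1, 1] - ψ ![1, 1, 0, 1])) / 2,
      -(ψ ![0, 0, 1, 1] - ψ ![1, 0, 0, 1])]), ?_, ?_⟩
  · apply ext_ket
    have e0 : ∀ i j, ψ ![i, j, i, j] = 0 := fun i j => self_eq_neg.mp (h i j i j)
    have e1 := h 0 1 0 0
    have e2 := h 1 0 0 0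
    have e3 := h 1 1 0 0
    have e4 := h 1 0 0 1
    have e5 := h 1 1 0 1
    have e6 := h 1 1 1 0
    rw [e1, e2, e4, e5, e6]
    intro i j k l
    rw [fermionicState_apply]
    fin_cases i <;> fin_cases j <;> fin_cases k <;> fin_cases l <;> 
      simp [eps, symMat, e0, e1, e2, e3, e4, e5, e6] <;> ring_nf <;> simp <;> ring_nf
  · rintro ⟨w, z⟩ rfl
    ext a
    · fin_cases a <;> simp [fermionicState_apply, eps, symMat] <;> ring_nf <;> simp
    · fin_cases a <;> simp [fermionicState_apply, eps, symMat] <;> ring_nf <;> simp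

lemma norm_sq_fermionicState (w z : EuclideanSpace ℂ (Fin 3)) :
    ‖fermionicState w z‖ ^ 2 = ‖w‖ ^ 2 + ‖z‖ ^ 2 := by
  rw [EuclideanSpace.norm_sq_eq, EuclideanSpace.norm_sq_eq, EuclideanSpace.norm_sq_eq, sum_qubits]
  simp only [fermionicState_apply, ← Complex.normSq_eq_norm_sq, Fin.sum_univ_two,
    Fin.sum_univ_three]
  simp [eps, symMat, Complex.normSq_apply]
  ring

theorem invH_fermionicState (w z : EuclideanSpace ℂ (Fin 3)) :
    invH (fermionicState w z) = -(1 / 2) * (bsq z + bsq w) := by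
  rw [invH]
  simp only [sum_qubits, fermionicState_apply, Fin.sum_univ_two, Fin.prod_univ_four, bsq,
    Fin.sum_univ_three]
  simp [eps, symMat]
  linear_combination (1 / 2 : ℂ) * (w 1 ^ 2 + z 1 ^ 2) * Complex.I_sq

theorem invL_fermionicState (w z : EuclideanSpace ℂ (Fin 3)) :
    invL (fermionicState w z) = 1 / 16 * (bsq z - bsq w) ^ 2 := by
  rw [invL, ← det_submatrix_equiv_self (finProdFinEquiv (m := 2) (n := 2)).symm]
  have h : ((Matrix.of fun p q : Fin 2 × Fin 2 =>
      fermionicState w z ![p.1, p.2, q.1, q.2]).submatrix (finProdFinEquiv (m := 2) (n := 2)).symm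
      (finProdFinEquiv (m := 2) (n := 2)).symm) = (1 / 2 : ℂ) •
      !![0, symMat w 0 0, symMat z 0 0, -z 2 - w 2;
        -symMat w 0 0, 0, w 2 - z 2, symMat z 1 1;
        -symMat z 0 0, z 2 - w 2, 0, symMat w 1 1;
        z 2 + w 2, -symMat z 1 1, -symMat w 1 1, 0] := by
    ext i j
    fin_cases i <;> fin_cases j <;>
      simp [fermionicState_apply, finProdFinEquiv, Fin.divNat, Fin.modNat, eps, symMat] <;> ring
  -- The square root of the determinant is the Pfaffian.
  have hpf : ∀ a a' c c' t u : ℂ, (!![0, a, c, -u - t; -a, 0, t - u, c'; -c, u - t, 0, a';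
      u + t, -c', -a', 0] : Matrix (Fin 4) (Fin 4) ℂ).det =
      (a * a' - t ^ 2 - (c * c' - u ^ 2)) ^ 2 := by
    intro a a' c c' t u
    simp [det_succ_row_zero, Fin.sum_univ_succ, Fin.succAbove]
    ring
  have hd : ∀ v : EuclideanSpace ℂ (Fin 3), symMat v 0 0 * symMat v 1 1 - v 2 ^ 2 = -bsq v := by
    intro v
    rw [← det_symMat, det_fin_two]
    simp [symMat]
    ring
  rw [h, det_smul, hpf, hd, hd]
  simp
  ring

/-! ### The reduced states of the antisymmetric states -/

section reduced
variable (w z : EuclideanSpace ℂ (Fin 3))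

lemma reduced2_fermionicState_zero_one : reduced2 (fermionicState w z) 0 1 =
    amplitude (symMat z) (symMat w) * (amplitude (symMat z) (symMat w))ᴴ := by
  ext p q
  rw [reduced2_zero_one, Matrix.mul_apply, Fintype.sum_prod_type]
  refine Finset.sum_congr rfl fun k _ => Finset.sum_congr rfl fun l _ => ?_
  simp [fermionicState_apply, amplitude_apply]

/-- Exchanging the indices `j` and `l` changes the sign of `w` only. -/
lemma reduced2_fermionicState_zero_three : reduced2 (fermionicState w z) 0 3 =
    amplitude (symMat z) (symMat (-w)) * (amplitude (symMat z) (symMat (-w)))ᴴ := by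
  ext p q
  rw [reduced2_zero_three, Matrix.mul_apply, Fintype.sum_prod_type, Finset.sum_comm]
  refine Finset.sum_congr rfl fun k _ => Finset.sum_congr rfl fun j _ => ?_
  simp [fermionicState_apply, amplitude_apply, symMat_neg, symMat_comm z j, eps_antisymm j]

/-- Exchanging the two pairs `(i, k)` and `(j, l)` swaps `w` and `z`; the order of `i` and `k`
accounts for a sign, which is moved to `z`. -/
lemma reduced2_fermionicState_one_two : reduced2 (fermionicState w z) 1 2 =
    amplitude (symMat w) (symMat (-z)) * (amplitude (symMat w) (symMat (-z)))ᴴ := by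
  ext p q
  rw [reduced2_one_two, Matrix.mul_apply, Fintype.sum_prod_type, Finset.sum_comm]
  refine Finset.sum_congr rfl fun l _ => Finset.sum_congr rfl fun i _ => ?_
  simp [fermionicState_apply, amplitude_apply, symMat_neg, symMat_comm w i, eps_antisymm i]
  ring

lemma reduced2_fermionicState_two_three : reduced2 (fermionicState w z) 2 3 =
    amplitude (symMat z) (symMat w) * (amplitude (symMat z) (symMat w))ᴴ := by
  ext p q
  rw [reduced2_two_three, Matrix.mul_apply, Fintype.sum_prod_type]
  refine Finset.sum_congr rfl fun i _ => Finset.sum_congr rfl fun j _ => ?_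
  simp [fermionicState_apply, amplitude_apply, symMat_comm _ i, symMat_comm _ j, eps_antisymm i,
    eps_antisymm j]
  ring

lemma norm_sq_eq_sum_symMat (v : EuclideanSpace ℂ (Fin 3)) : ((‖v‖ ^ 2 : ℝ) : ℂ) =
    1 / 2 * ∑ i, ∑ j, symMat v i j * star (symMat v i j) := by
  have h := trace_symMat_mul_conjTranspose v
  simp only [trace, diag_apply, Matrix.mul_apply, conjTranspose_apply] at h
  rw [h]
  ring

lemma reduced2_fermionicState_zero_two : reduced2 (fermionicState w z) 0 2 =
    singletMixture (‖z‖ ^ 2) (symMat w) := by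
  ext p q
  rw [reduced2_zero_two, singletMixture, Matrix.of_apply, norm_sq_eq_sum_symMat]
  simp only [fermionicState_apply, Fin.sum_univ_two, symMat_comm z 1 0]
  simp [eps]
  ring

lemma reduced2_fermionicState_one_three : reduced2 (fermionicState w z) 1 3 =
    singletMixture (‖w‖ ^ 2) (symMat z) := by
  ext p q
  rw [reduced2_one_three, singletMixture, Matrix.of_apply, norm_sq_eq_sum_symMat]
  simp only [fermionicState_apply, Fin.sum_univ_two, symMat_comm w 1 0]
  simp [eps]
  ring

lemma reduced1_fermionicState_zero : reduced1 (fermionicState w z) 0 =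
    (1 / 2 : ℂ) • (((‖z‖ ^ 2 : ℝ) : ℂ) • 1 + symMat w * (symMat w)ᴴ) := by
  ext p q
  rw [reduced1_zero, norm_sq_eq_sum_symMat]
  fin_cases p <;> fin_cases q <;>
    simp [fermionicState_apply, Fin.sum_univ_two, symMat_comm _ 1 0, eps, Matrix.mul_apply] <;>
    ring

lemma reduced1_fermionicState_two : reduced1 (fermionicState w z) 2 =
    (1 / 2 : ℂ) • (((‖z‖ ^ 2 : ℝ) : ℂ) • 1 + symMat w * (symMat w)ᴴ) := by
  ext p q
  rw [reduced1_two, norm_sq_eq_sum_symMat]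
  fin_cases p <;> fin_cases q <;>
    simp [fermionicState_apply, Fin.sum_univ_two, symMat_comm _ 1 0, eps, Matrix.mul_apply] <;>
    ring

lemma reduced1_fermionicState_one : reduced1 (fermionicState w z) 1 =
    (1 / 2 : ℂ) • (((‖w‖ ^ 2 : ℝ) : ℂ) • 1 + symMat z * (symMat z)ᴴ) := by
  ext p q
  rw [reduced1_one, norm_sq_eq_sum_symMat]
  fin_cases p <;> fin_cases q <;>
    simp [fermionicState_apply, Fin.sum_univ_two, symMat_comm _ 1 0, eps, Matrix.mul_apply] <;>
    ring

lemma reduced1_fermionicState_three : reduced1 (fermionicState w z) 3 =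
    (1 / 2 : ℂ) • (((‖w‖ ^ 2 : ℝ) : ℂ) • 1 + symMat z * (symMat z)ᴴ) := by
  ext p q
  rw [reduced1_three, norm_sq_eq_sum_symMat]
  fin_cases p <;> fin_cases q <;>
    simp [fermionicState_apply, Fin.sum_univ_two, symMat_comm _ 1 0, eps, Matrix.mul_apply] <;>
    ring

end reduced

/-- The trace and the determinant of the one-qubit state determine its purity. -/
lemma concurrenceSq_symMat {w z : EuclideanSpace ℂ (Fin 3)} (hwz : ‖w‖ ^ 2 + ‖z‖ ^ 2 = 1) :
    concurrenceSq ((1 / 2 : ℂ) • (((‖z‖ ^ 2 : ℝ) : ℂ) • 1 + symMat w * (symMat w)ᴴ)) =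
      1 - crossNorm w ^ 2 := by
  have htr : ∀ N : Matrix (Fin 2) (Fin 2) ℂ, (N * N).trace = N.trace ^ 2 - 2 * N.det := by
    intro N
    simp [trace_fin_two, det_fin_two, Matrix.mul_apply]
    ring
  have hdet : ∀ (t : ℂ) (N : Matrix (Fin 2) (Fin 2) ℂ),
      (t • 1 + N).det = t ^ 2 + t * N.trace + N.det := by
    intro t N
    simp [trace_fin_two, det_fin_two]
    ring
  have hb : bsq w * star (bsq w) = ((‖bsq w‖ ^ 2 : ℝ) : ℂ) := by
    simpa using Complex.mul_conj' (bsq w)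
  have hN : (((1 / 2 : ℂ) • (((‖z‖ ^ 2 : ℝ) : ℂ) • 1 + symMat w * (symMat w)ᴴ)) *
      ((1 / 2 : ℂ) • (((‖z‖ ^ 2 : ℝ) : ℂ) • 1 + symMat w * (symMat w)ᴴ))).trace =
      (((‖z‖ ^ 2 + ‖w‖ ^ 2) ^ 2 - 1 / 2 * ((‖z‖ ^ 2) ^ 2 + ‖z‖ ^ 2 * (2 * ‖w‖ ^ 2) +
        ‖bsq w‖ ^ 2) : ℝ) : ℂ) := by
    rw [htr, det_smul, hdet, trace_smul, trace_add, trace_smul, trace_symMat_mul_conjTranspose,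
      det_mul, det_conjTranspose, det_symMat, star_neg, neg_mul_neg, hb]
    simp
    ring
  rw [concurrenceSq, hN, Complex.ofReal_re, crossNorm_sq, add_comm (‖z‖ ^ 2) (‖w‖ ^ 2), hwz]
  simp only [Fintype.card_fin]
  push_cast
  linear_combination (‖w‖ ^ 2 + ‖z‖ ^ 2 + 1) * hwz

lemma bsq_neg (v : EuclideanSpace ℂ (Fin 3)) : bsq (-v) = bsq v := by simp [bsq]

lemma crossNorm_neg (v : EuclideanSpace ℂ (Fin 3)) : crossNorm (-v) = crossNorm v := by
  rw [← sq_eq_sq₀ (crossNorm_nonneg _) (crossNorm_nonneg _), crossNorm_sq, crossNorm_sq, bsq_neg,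
    norm_neg]

/-- The concurrence of the reduced states of the pairs 12, 14, 23 and 34. -/
noncomputable def crossConcurrence (w z : EuclideanSpace ℂ (Fin 3)) : ℝ :=
  1 / 2 * max 0 (√(1 - eta w z ^ 2 - (crossNorm w - crossNorm z) ^ 2) -
    √(1 - (crossNorm w + crossNorm z) ^ 2))

lemma crossConcurrence_neg_left (w z : EuclideanSpace ℂ (Fin 3)) :
    crossConcurrence (-w) z = crossConcurrence w z := by
  rw [crossConcurrence, crossConcurrence, crossNorm_neg, eta, eta, bsq_neg]

lemma eta_comm (w z : EuclideanSpace ℂ (Fin 3)) : eta w z = eta z w := norm_sub_rev _ _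

lemma crossConcurrence_comm (w z : EuclideanSpace ℂ (Fin 3)) :
    crossConcurrence w z = crossConcurrence z w := by
  rw [crossConcurrence, crossConcurrence, eta_comm, add_comm (crossNorm w),
    ← neg_sub (crossNorm z), neg_sq]

theorem concurrence_isSeparable_cross {w z : EuclideanSpace ℂ (Fin 3)}
    (hwz : ‖w‖ ^ 2 + ‖z‖ ^ 2 = 1) : ∀ ρ ∈ [reduced2 (fermionicState w z) 0 1,
    reduced2 (fermionicState w z) 0 3, reduced2 (fermionicState w z) 1 2,
    reduced2 (fermionicState w z) 2 3],
    concurrence ρ = crossConcurrence w z ∧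
      (IsSeparable ρ ↔ 4 * crossNorm w * crossNorm z ≤ eta w z ^ 2) := by
  have h14 := concurrence_isSeparable_amplitude (-w) z (by rwa [norm_neg])
    (reduced2_fermionicState_zero_three w z)
  have h23 := concurrence_isSeparable_amplitude (-z) w (by rw [norm_neg, add_comm, hwz])
    (reduced2_fermionicState_one_two w z)
  rw [← crossConcurrence, crossConcurrence_neg_left, crossNorm_neg, eta, bsq_neg, ← eta] at h14
  rw [← crossConcurrence, crossConcurrence_neg_left, ← crossConcurrence_comm, crossNorm_neg, eta,
    bsq_neg, ← eta, ← eta_comm, mul_assoc, mul_comm (crossNorm z), ← mul_assoc] at h23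
  intro ρ hρ
  simp only [List.mem_cons, List.not_mem_nil, or_false] at hρ
  rcases hρ with rfl | rfl | rfl | rfl
  · exact concurrence_isSeparable_amplitude w z hwz (reduced2_fermionicState_zero_one w z)
  · exact h14
  · exact h23
  · exact concurrence_isSeparable_amplitude w z hwz (reduced2_fermionicState_two_three w z)

/-! ### Residual tangles -/

lemma posSemidef_reduced2_zero_one (w z : EuclideanSpace ℂ (Fin 3)) :
    (reduced2 (fermionicState w z) 0 1).PosSemidef :=
  reduced2_fermionicState_zero_one w z ▸ posSemidef_self_mul_conjTranspose _

lemma posSemidef_reduced2_zero_three (w z : EuclideanSpace ℂ (Fin 3)) :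
    (reduced2 (fermionicState w z) 0 3).PosSemidef :=
  reduced2_fermionicState_zero_three w z ▸ posSemidef_self_mul_conjTranspose _

lemma posSemidef_reduced2_one_two (w z : EuclideanSpace ℂ (Fin 3)) :
    (reduced2 (fermionicState w z) 1 2).PosSemidef :=
  reduced2_fermionicState_one_two w z ▸ posSemidef_self_mul_conjTranspose _

lemma posSemidef_reduced2_two_three (w z : EuclideanSpace ℂ (Fin 3)) :
    (reduced2 (fermionicState w z) 2 3).PosSemidef :=
  reduced2_fermionicState_two_three w z ▸ posSemidef_self_mul_conjTranspose _

lemma concurrence_sq_zero_two (w z : EuclideanSpace ℂ (Fin 3)) :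
    concurrence (reduced2 (fermionicState w z) 0 2) ^ 2 = (‖z‖ ^ 2 - ‖bsq w‖) ^ 2 := by
  rw [reduced2_fermionicState_zero_two, concurrence_singletMixture (sq_nonneg _), sq_abs]

lemma concurrence_sq_one_three (w z : EuclideanSpace ℂ (Fin 3)) :
    concurrence (reduced2 (fermionicState w z) 1 3) ^ 2 = (‖w‖ ^ 2 - ‖bsq z‖) ^ 2 := by
  rw [reduced2_fermionicState_one_three, concurrence_singletMixture (sq_nonneg _), sq_abs]

theorem residualTangle_fermionicState {w z : EuclideanSpace ℂ (Fin 3)}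
    (hwz : ‖w‖ ^ 2 + ‖z‖ ^ 2 = 1) (a : Fin 4) :
    residualTangle (fermionicState w z) a =
      ![1 - crossNorm w ^ 2 - (2 * crossConcurrence w z ^ 2 + (‖z‖ ^ 2 - ‖bsq w‖) ^ 2),
        1 - crossNorm z ^ 2 - (2 * crossConcurrence w z ^ 2 + (‖w‖ ^ 2 - ‖bsq z‖) ^ 2),
        1 - crossNorm w ^ 2 - (2 * crossConcurrence w z ^ 2 + (‖z‖ ^ 2 - ‖bsq w‖) ^ 2),
        1 - crossNorm z ^ 2 - (2 * crossConcurrence w z ^ 2 + (‖w‖ ^ 2 - ‖bsq z‖) ^ 2)] a := by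
  have hc := concurrence_isSeparable_cross hwz
  have hzw : ‖z‖ ^ 2 + ‖w‖ ^ 2 = 1 := by rwa [add_comm]
  set ψ := fermionicState w z with hψ
  have c01 := (hc (reduced2 ψ 0 1) (by simp)).1
  have c03 := (hc (reduced2 ψ 0 3) (by simp)).1
  have c12 := (hc (reduced2 ψ 1 2) (by simp)).1
  have c23 := (hc (reduced2 ψ 2 3) (by simp)).1
  have c10 : concurrence (reduced2 ψ 1 0) = crossConcurrence w z := by
    rw [reduced2_swap ψ (a := 0) (by decide), concurrence_swap (posSemidef_reduced2_zero_one w z),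
      c01]
  have c30 : concurrence (reduced2 ψ 3 0) = crossConcurrence w z := by
    rw [reduced2_swap ψ (a := 0) (by decide),
      concurrence_swap (posSemidef_reduced2_zero_three w z), c03]
  have c21 : concurrence (reduced2 ψ 2 1) = crossConcurrence w z := by
    rw [reduced2_swap ψ (a := 1) (by decide), concurrence_swap (posSemidef_reduced2_one_two w z),
      c12]
  have c32 : concurrence (reduced2 ψ 3 2) = crossConcurrence w z := by
    rw [reduced2_swap ψ (a := 2) (by decide),
      concurrence_swap (posSemidef_reduced2_two_three w z), c23]
  have c20 : concurrence (reduced2 ψ 2 0) = concurrence (reduced2 ψ 0 2) := by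
    rw [reduced2_swap ψ (a := 0) (by decide), concurrence_swap]
    rw [hψ, reduced2_fermionicState_zero_two]
    exact posSemidef_singletMixture (sq_nonneg _) _
  have c31 : concurrence (reduced2 ψ 3 1) = concurrence (reduced2 ψ 1 3) := by
    rw [reduced2_swap ψ (a := 1) (by decide), concurrence_swap]
    rw [hψ, reduced2_fermionicState_one_three]
    exact posSemidef_singletMixture (sq_nonneg _) _
  have c02 : concurrence (reduced2 ψ 0 2) ^ 2 = _ := concurrence_sq_zero_two w z
  have c13 : concurrence (reduced2 ψ 1 3) ^ 2 = _ := concurrence_sq_one_three w z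
  fin_cases a
  · simp only [residualTangle, Fin.zero_eta, cons_val_zero,
      show Finset.univ.erase (0 : Fin 4) = {1, 2, 3} by decide]
    rw [hψ, reduced1_fermionicState_zero, concurrenceSq_symMat hwz, ← hψ]
    simp [c01, c02, c03]
    ring
  · simp only [residualTangle, Fin.mk_one, cons_val_one,
      show Finset.univ.erase (1 : Fin 4) = {0, 2, 3} by decide]
    rw [hψ, reduced1_fermionicState_one, concurrenceSq_symMat hzw, ← hψ]
    simp [c10, c12, c13]
    ring
  · simp only [residualTangle, Fin.reduceFinMk, cons_val,
      show Finset.univ.erase (2 : Fin 4) = {0, 1, 3} by decide]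
    rw [hψ, reduced1_fermionicState_two, concurrenceSq_symMat hwz, ← hψ]
    simp [c20, c02, c21, c23]
    ring
  · simp only [residualTangle, Fin.reduceFinMk, cons_val,
      show Finset.univ.erase (3 : Fin 4) = {0, 1, 2} by decide]
    rw [hψ, reduced1_fermionicState_three, concurrenceSq_symMat hzw, ← hψ]
    simp [c30, c31, c13, c32]
    ring

lemma eta_sq_add_sigma_sq (w z : EuclideanSpace ℂ (Fin 3)) :
    eta w z ^ 2 + sigma w z ^ 2 = 2 * (‖bsq w‖ ^ 2 + ‖bsq z‖ ^ 2) := by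
  have := parallelogram_law_with_norm ℝ (bsq w) (bsq z)
  rw [eta, sigma]
  linarith

lemma crossNorm_mul_le (w z : EuclideanSpace ℂ (Fin 3)) :
    crossNorm w * crossNorm z ≤ ‖w‖ ^ 2 * ‖z‖ ^ 2 := by
  have h : ∀ v : EuclideanSpace ℂ (Fin 3), crossNorm v ≤ ‖v‖ ^ 2 := fun v => by
    refine abs_le_of_sq_le_sq' ?_ (sq_nonneg _) |>.2
    rw [crossNorm_sq]
    linarith [sq_nonneg ‖bsq v‖]
  exact mul_le_mul (h w) (h z) (crossNorm_nonneg z) (sq_nonneg _)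

lemma pMinus_nonneg (w z : EuclideanSpace ℂ (Fin 3)) : 0 ≤ pMinus w z := by
  rw [pMinus]
  linarith [crossNorm_mul_le w z, sq_nonneg (eta w z)]

lemma pPlus_nonneg {w z : EuclideanSpace ℂ (Fin 3)}
    (h : eta w z ^ 2 ≤ 4 * crossNorm w * crossNorm z) : 0 ≤ pPlus w z := by
  have : 0 ≤ 2 * ‖z‖ ^ 2 * ‖w‖ ^ 2 := by positivity
  rw [pPlus]
  linarith

/-- The first radicand in the concurrence of the pair 12, in terms of `σ` and `p_+`. -/
lemma half_sigma_sq_add_pPlus {w z : EuclideanSpace ℂ (Fin 3)} (hwz : ‖w‖ ^ 2 + ‖z‖ ^ 2 = 1) :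
    1 / 2 * sigma w z ^ 2 + pPlus w z =
      1 - eta w z ^ 2 - (crossNorm w - crossNorm z) ^ 2 := by
  rw [pPlus]
  linear_combination (1 / 2 : ℝ) * eta_sq_add_sigma_sq w z + crossNorm_sq w + crossNorm_sq z +
    (‖w‖ ^ 2 + ‖z‖ ^ 2 + 1) * hwz

/-- The second radicand in the concurrence of the pair 12, in terms of `σ` and `p_-`. -/
lemma half_sigma_sq_add_pMinus {w z : EuclideanSpace ℂ (Fin 3)} (hwz : ‖w‖ ^ 2 + ‖z‖ ^ 2 = 1) :
    1 / 2 * sigma w z ^ 2 + pMinus w z = 1 - (crossNorm w + crossNorm z) ^ 2 := by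
  rw [pMinus]
  linear_combination (1 / 2 : ℝ) * eta_sq_add_sigma_sq w z + crossNorm_sq w + crossNorm_sq z +
    (‖w‖ ^ 2 + ‖z‖ ^ 2 + 1) * hwz

lemma crossConcurrence_eq_zero {w z : EuclideanSpace ℂ (Fin 3)}
    (h : 4 * crossNorm w * crossNorm z ≤ eta w z ^ 2) : crossConcurrence w z = 0 := by
  rw [crossConcurrence, max_eq_left, mul_zero]
  rw [sub_nonpos]
  apply Real.sqrt_le_sqrt
  linarith

lemma two_mul_crossConcurrence_sq {w z : EuclideanSpace ℂ (Fin 3)}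
    (hwz : ‖w‖ ^ 2 + ‖z‖ ^ 2 = 1) (h : eta w z ^ 2 ≤ 4 * crossNorm w * crossNorm z) :
    2 * crossConcurrence w z ^ 2 = 1 - crossNorm w ^ 2 - crossNorm z ^ 2 - 1 / 2 * eta w z ^ 2 -
      √((1 - eta w z ^ 2 - (crossNorm w - crossNorm z) ^ 2) *
        (1 - (crossNorm w + crossNorm z) ^ 2)) := by
  have hσ := sq_nonneg (sigma w z)
  have hA : 0 ≤ 1 - eta w z ^ 2 - (crossNorm w - crossNorm z) ^ 2 := by
    rw [← half_sigma_sq_add_pPlus hwz]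
    linarith [pPlus_nonneg h]
  have hB : 0 ≤ 1 - (crossNorm w + crossNorm z) ^ 2 := by
    rw [← half_sigma_sq_add_pMinus hwz]
    linarith [pMinus_nonneg w z]
  rw [crossConcurrence, max_eq_right (sub_nonneg.mpr (Real.sqrt_le_sqrt (by linarith))),
    Real.sqrt_mul hA]
  linear_combination (1 / 2 : ℝ) * Real.sq_sqrt hA + (1 / 2 : ℝ) * Real.sq_sqrt hB

theorem residualTangle_of_not_separable {w z : EuclideanSpace ℂ (Fin 3)}
    (hwz : ‖w‖ ^ 2 + ‖z‖ ^ 2 = 1) (h : eta w z ^ 2 ≤ 4 * crossNorm w * crossNorm z) (a : Fin 4) :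
    residualTangle (fermionicState w z) a =
      2 * ![‖z‖ ^ 2 * ‖bsq w‖, ‖w‖ ^ 2 * ‖bsq z‖, ‖z‖ ^ 2 * ‖bsq w‖, ‖w‖ ^ 2 * ‖bsq z‖] a
        + √((1 / 2 * sigma w z ^ 2 + pPlus w z) * (1 / 2 * sigma w z ^ 2 + pMinus w z))
        - 1 / 2 * sigma w z ^ 2 := by
  have h1 := two_mul_crossConcurrence_sq hwz h
  have h2 := eta_sq_add_sigma_sq w z
  rw [residualTangle_fermionicState hwz, half_sigma_sq_add_pPlus hwz, half_sigma_sq_add_pMinus hwz,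
    h1]
  fin_cases a <;> simp
  · linear_combination crossNorm_sq z + (1 / 2 : ℝ) * h2
  · linear_combination crossNorm_sq w + (1 / 2 : ℝ) * h2
  · linear_combination crossNorm_sq z + (1 / 2 : ℝ) * h2
  · linear_combination crossNorm_sq w + (1 / 2 : ℝ) * h2

theorem residualTangle_of_separable {w z : EuclideanSpace ℂ (Fin 3)}
    (hwz : ‖w‖ ^ 2 + ‖z‖ ^ 2 = 1) (h : 4 * crossNorm w * crossNorm z ≤ eta w z ^ 2) (a : Fin 4) :
    residualTangle (fermionicState w z) a =
      2 * ![‖z‖ ^ 2 * (‖bsq w‖ + ‖w‖ ^ 2), ‖w‖ ^ 2 * (‖bsq z‖ + ‖z‖ ^ 2),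
        ‖z‖ ^ 2 * (‖bsq w‖ + ‖w‖ ^ 2), ‖w‖ ^ 2 * (‖bsq z‖ + ‖z‖ ^ 2)] a := by
  rw [residualTangle_fermionicState hwz, crossConcurrence_eq_zero h]
  fin_cases a <;> simp
  · linear_combination -crossNorm_sq w - (‖w‖ ^ 2 + ‖z‖ ^ 2 + 1) * hwz
  · linear_combination -crossNorm_sq z - (‖w‖ ^ 2 + ‖z‖ ^ 2 + 1) * hwz
  · linear_combination -crossNorm_sq w - (‖w‖ ^ 2 + ‖z‖ ^ 2 + 1) * hwz
  · linear_combination -crossNorm_sq z - (‖w‖ ^ 2 + ‖z‖ ^ 2 + 1) * hwz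

theorem residualTangle_nonneg {w z : EuclideanSpace ℂ (Fin 3)}
    (hwz : ‖w‖ ^ 2 + ‖z‖ ^ 2 = 1) (a : Fin 4) : 0 ≤ residualTangle (fermionicState w z) a := by
  rcases le_total (4 * crossNorm w * crossNorm z) (eta w z ^ 2) with h | h
  · rw [residualTangle_of_separable hwz h]
    fin_cases a <;> simp <;> positivity
  · rw [residualTangle_of_not_separable hwz h]
    have hroot : 1 / 2 * sigma w z ^ 2 ≤
        √((1 / 2 * sigma w z ^ 2 + pPlus w z) * (1 / 2 * sigma w z ^ 2 + pMinus w z)) := by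
      have hσ : 0 ≤ 1 / 2 * sigma w z ^ 2 := by positivity
      refine Real.le_sqrt_of_sq_le ?_
      rw [pow_two]
      exact mul_le_mul (by linarith [pPlus_nonneg h]) (by linarith [pMinus_nonneg w z]) hσ
        (by linarith [pPlus_nonneg h])
    have : (0 : ℝ) ≤ 2 * ![‖z‖ ^ 2 * ‖bsq w‖, ‖w‖ ^ 2 * ‖bsq z‖, ‖z‖ ^ 2 * ‖bsq w‖,
        ‖w‖ ^ 2 * ‖bsq z‖] a := by
      fin_cases a <;> simp <;> positivity
    linarith

end FourQubit

theorem mainTheorem9 (ψ : FourQubit.Ket) (hanti : FourQubit.IsAntisymm ψ) (hnorm : ‖ψ‖ = 1) :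
    -- the parametrization covers every such state, uniquely
    (∃! p : EuclideanSpace ℂ (Fin 3) × EuclideanSpace ℂ (Fin 3),
      ψ = FourQubit.fermionicState p.1 p.2) ∧
    -- the monogamy inequalities, for every qubit
    (∀ a : Fin 4,
      ∑ b ∈ Finset.univ.erase a, FourQubit.concurrence (FourQubit.reduced2 ψ a b) ^ 2
        ≤ FourQubit.concurrenceSq (FourQubit.reduced1 ψ a)) ∧
    ∀ w z : EuclideanSpace ℂ (Fin 3), ψ = FourQubit.fermionicState w z →
    ∀ r s η σ : ℝ, r = FourQubit.crossNorm w → s = FourQubit.crossNorm z →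
      η = FourQubit.eta w z → σ = FourQubit.sigma w z →
      ‖w‖ ^ 2 + ‖z‖ ^ 2 = 1 ∧
      -- the four-qubit invariants
      FourQubit.invH ψ = -(1 / 2) * (FourQubit.bsq z + FourQubit.bsq w) ∧
      FourQubit.invL ψ = 1 / 16 * (FourQubit.bsq z - FourQubit.bsq w) ^ 2 ∧
      ‖FourQubit.invL ψ‖ = 1 / 16 * η ^ 2 ∧
      2 * ‖FourQubit.invH ψ‖ = σ ∧
      -- one-qubit subsystems
      FourQubit.concurrenceSq (FourQubit.reduced1 ψ 0) = 1 - r ^ 2 ∧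
      FourQubit.concurrenceSq (FourQubit.reduced1 ψ 2) = 1 - r ^ 2 ∧
      FourQubit.concurrenceSq (FourQubit.reduced1 ψ 1) = 1 - s ^ 2 ∧
      FourQubit.concurrenceSq (FourQubit.reduced1 ψ 3) = 1 - s ^ 2 ∧
      -- the two-qubit subsystems 12, 14, 23, 34
      (∀ ρ ∈ [FourQubit.reduced2 ψ 0 1, FourQubit.reduced2 ψ 0 3,
          FourQubit.reduced2 ψ 1 2, FourQubit.reduced2 ψ 2 3],
        FourQubit.concurrence ρ =
          1 / 2 * max 0 (√(1 - η ^ 2 - (r - s) ^ 2) - √(1 - (r + s) ^ 2)) ∧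
        (FourQubit.IsSeparable ρ ↔ 4 * r * s ≤ η ^ 2)) ∧
      -- the two-qubit subsystems 13 and 24
      FourQubit.concurrence (FourQubit.reduced2 ψ 0 2) ^ 2
        = (‖z‖ ^ 2 - ‖FourQubit.bsq w‖) ^ 2 ∧
      FourQubit.concurrence (FourQubit.reduced2 ψ 1 3) ^ 2
        = (‖w‖ ^ 2 - ‖FourQubit.bsq z‖) ^ 2 ∧
      FourQubit.concurrence (FourQubit.reduced2 ψ 0 2) ^ 2
        = s ^ 2 + 1 / 2 * (η ^ 2 + σ ^ 2) - 2 * ‖z‖ ^ 2 * ‖FourQubit.bsq w‖ ∧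
      FourQubit.concurrence (FourQubit.reduced2 ψ 1 3) ^ 2
        = r ^ 2 + 1 / 2 * (η ^ 2 + σ ^ 2) - 2 * ‖w‖ ^ 2 * ‖FourQubit.bsq z‖ ∧
      -- the residual tangles
      0 ≤ FourQubit.pMinus w z ∧
      (¬ FourQubit.IsSeparable (FourQubit.reduced2 ψ 0 1) →
        0 ≤ FourQubit.pPlus w z ∧
        FourQubit.concurrence (FourQubit.reduced2 ψ 0 1) ^ 2
            + FourQubit.concurrence (FourQubit.reduced2 ψ 0 3) ^ 2
          = 1 - r ^ 2 - s ^ 2 - 1 / 2 * η ^ 2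
            - √((1 - η ^ 2 - (r - s) ^ 2) * (1 - (r + s) ^ 2)) ∧
        FourQubit.residualTangle ψ 0
          = 2 * ‖z‖ ^ 2 * ‖FourQubit.bsq w‖
            + √((1 / 2 * σ ^ 2 + FourQubit.pPlus w z) * (1 / 2 * σ ^ 2 + FourQubit.pMinus w z))
            - 1 / 2 * σ ^ 2 ∧
        FourQubit.residualTangle ψ 1
          = 2 * ‖w‖ ^ 2 * ‖FourQubit.bsq z‖
            + √((1 / 2 * σ ^ 2 + FourQubit.pPlus w z) * (1 / 2 * σ ^ 2 + FourQubit.pMinus w z))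
            - 1 / 2 * σ ^ 2) ∧
      (FourQubit.IsSeparable (FourQubit.reduced2 ψ 0 1) →
        FourQubit.residualTangle ψ 0
          = 2 * ‖z‖ ^ 2 * (‖FourQubit.bsq w‖ + ‖w‖ ^ 2) ∧
        FourQubit.residualTangle ψ 1
          = 2 * ‖w‖ ^ 2 * (‖FourQubit.bsq z‖ + ‖z‖ ^ 2)) := by
  have hex := FourQubit.existsUnique_parameters hanti
  refine ⟨hex, ?_, ?_⟩
  · obtain ⟨⟨w, z⟩, rfl, -⟩ := hex
    have hwz : ‖w‖ ^ 2 + ‖z‖ ^ 2 = 1 := by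
      rw [← FourQubit.norm_sq_fermionicState, hnorm, one_pow]
    exact fun a => sub_nonneg.mp (FourQubit.residualTangle_nonneg hwz a)
  · rintro w z rfl r s η σ rfl rfl rfl rfl
    have hwz : ‖w‖ ^ 2 + ‖z‖ ^ 2 = 1 := by
      rw [← FourQubit.norm_sq_fermionicState, hnorm, one_pow]
    have hzw : ‖z‖ ^ 2 + ‖w‖ ^ 2 = 1 := by rwa [add_comm]
    have hcross := FourQubit.concurrence_isSeparable_cross hwz
    have h12 := hcross (FourQubit.reduced2 (FourQubit.fermionicState w z) 0 1) (by simp)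
    have h14 := hcross (FourQubit.reduced2 (FourQubit.fermionicState w z) 0 3) (by simp)
    have hpar := FourQubit.eta_sq_add_sigma_sq w z
    have hw := FourQubit.crossNorm_sq w
    have hz := FourQubit.crossNorm_sq z
    refine ⟨hwz, FourQubit.invH_fermionicState w z, FourQubit.invL_fermionicState w z, ?_, ?_, ?_,
      ?_, ?_, ?_, hcross, FourQubit.concurrence_sq_zero_two w z,
      FourQubit.concurrence_sq_one_three w z, ?_, ?_, FourQubit.pMinus_nonneg w z, ?_, ?_⟩
    · rw [FourQubit.invL_fermionicState, FourQubit.eta, norm_mul, norm_pow, norm_sub_rev]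
      norm_num
    · rw [FourQubit.invH_fermionicState, FourQubit.sigma, norm_mul, norm_neg, add_comm]
      norm_num
      ring
    · rw [FourQubit.reduced1_fermionicState_zero, FourQubit.concurrenceSq_symMat hwz]
    · rw [FourQubit.reduced1_fermionicState_two, FourQubit.concurrenceSq_symMat hwz]
    · rw [FourQubit.reduced1_fermionicState_one, FourQubit.concurrenceSq_symMat hzw]
    · rw [FourQubit.reduced1_fermionicState_three, FourQubit.concurrenceSq_symMat hzw]
    · rw [FourQubit.concurrence_sq_zero_two]
      linear_combination -hz - (1 / 2 : ℝ) * hpar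
    · rw [FourQubit.concurrence_sq_one_three]
      linear_combination -hw - (1 / 2 : ℝ) * hpar
    · intro hns
      have h : FourQubit.eta w z ^ 2 ≤ 4 * FourQubit.crossNorm w * FourQubit.crossNorm z :=
        (not_le.mp (mt h12.2.mpr hns)).le
      refine ⟨FourQubit.pPlus_nonneg h, ?_, ?_, ?_⟩
      · rw [h12.1, h14.1, ← two_mul, FourQubit.two_mul_crossConcurrence_sq hwz h]
      · rw [FourQubit.residualTangle_of_not_separable hwz h, mul_assoc 2 (‖z‖ ^ 2)]
        rfl
      · rw [FourQubit.residualTangle_of_not_separable hwz h, mul_assoc 2 (‖w‖ ^ 2)]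
        rfl
    · intro hsep
      have h := h12.2.mp hsep
      constructor
      · rw [FourQubit.residualTangle_of_separable hwz h, mul_assoc 2 (‖z‖ ^ 2)]
        rfl
      · rw [FourQubit.residualTangle_of_separable hwz h, mul_assoc 2 (‖w‖ ^ 2)]
        rfl
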